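/- Let $\Psi:(0,\infty)\to(0,\infty)$ and $\omega:(0,\infty)\to(0,1)$ be functions. Let $E(\Psi,\omega)$ be the set of $x\in\mathbb R$ such that $|x-p/q|\le\Psi(q)$ for infinitely many $(p,q)\in\mathbb Z\times\mathbb N$ and such that, for all sufficiently large $q\in\mathbb N$, $|x-p/q|\ge(1-\omega(q))\Psi(q)$ for every $p\in\mathbb Z$ (here $\mathbb N=\{1,2,\dots\}$). Assume that - $q\mapsto q^2\Psi(q)$ and $q\mapsto q^2\Psi(q)\omega(q)$ are non-increasing on $(0,\infty)$; - $\Psi$ satisfies the square divisibility condition: for every $q\in\mathbb N$, $\Psi(q)^{-1}$ is an integer divisible by $q^2$; - $\sum_{q=1}^\infty q\Psi(q)<\infty$ and $\lim_{q\to\infty}\omega(q)=0$; - for all sufficiently large $q\in\mathbb N$, $\omega(q)\ge\frac{45}{16\,\Psi(q)}\,\Psi\!\left(\frac{1}{8\Psi(q)}\right)$. Then the Hausdorff dimension of $E(\Psi,\omega)$ is $$\dim_H E(\Psi,\omega)=\inf\Big\{s\ge 0:\ \sum_{q=1}^\infty q\,(\Psi(q)\omega(q))^s<\infty\Big\}=\frac{2}{\lambda(\Psi,\omega)},$$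 where $$\lambda(\Psi,\omega)=\liminf_{q\to\infty}\frac{-\log(\Psi(q)\omega(q))}{\log q}\in(0,\infty]$$ is the lower order at infinity of $\Psi\cdot\omega$ ($q$ ranging over the reals), and $2/\infty=0$. -/

import Mathlib

open Filter Set Topology
open scoped NNReal ENNReal

/-- The set `W(Ψ)` of `Ψ`-approximable real numbers: those `x` for which
`|x - p / q| ≤ Ψ q` holds for infinitely many pairs `(p, q)` of an integer `p` and a
positive integer `q` (not assumed coprime). -/
def approximableSet (Ψ : ℝ → ℝ) : Set ℝ :=
  {x | {r : ℤ × ℕ | 0 < r.2 ∧ |x - (r.1 : ℝ) / (r.2 : ℝ)| ≤ Ψ (r.2 : ℝ)}.Infinite}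

/-- The set `E(Ψ, ω)` of real numbers of exact `(Ψ, ω)`-order of approximation. -/
def exactSet (Ψ ω : ℝ → ℝ) : Set ℝ :=
  {x | x ∈ approximableSet Ψ ∧
    ∀ᶠ q : ℕ in atTop, ∀ p : ℤ, (1 - ω q) * Ψ q ≤ |x - (p : ℝ) / (q : ℝ)|}

/-- The square divisibility condition: for every positive integer `q`, the number `1 / Ψ q`
is an integer multiple of `q ^ 2`. -/
def SquareDivisibility (Ψ : ℝ → ℝ) : Prop :=
  ∀ q : ℕ, 0 < q → ∃ m : ℤ, (Ψ q)⁻¹ = (q : ℝ) ^ 2 * (m : ℝ)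

/-- The infimum, in `[0, ∞]`, of the real `s ≥ 0` for which `∑_{q ≥ 1} q (Ψ q ω q) ^ s` converges.
The term of index `q = 0` in the series below is zero because of its first factor. -/
noncomputable def convergenceExponent (Ψ ω : ℝ → ℝ) : ℝ≥0∞ :=
  sInf {t : ℝ≥0∞ | ∃ s : ℝ≥0, t = (s : ℝ≥0∞) ∧
    Summable fun q : ℕ => (q : ℝ) * (Ψ q * ω q) ^ (s : ℝ)}

/-- The lower order at infinity `λ(Ψ, ω)` of `Ψ ω`, as an extended real number: the lower limit of
`-log (Ψ q ω q) / log q` as the real variable `q` tends to infinity. -/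
noncomputable def lowerOrder (Ψ ω : ℝ → ℝ) : EReal :=
  liminf (fun q : ℝ => ((-Real.log (Ψ q * ω q) / Real.log q : ℝ) : EReal)) atTop

/-!
The upper bound is a covering argument: up to finitely many denominators, `exactSet Ψ ω` is covered
by two intervals of length about `Ψ q * ω q` near each fraction `p / q`.

For the lower bound, let `w` be a rational of denominator `d`, far from all rationals of smaller
denominator, and consider the interval of length `Ψ d * ω d` to the left of `w + Ψ d`. By square
divisibility, a rational `v` near this interval yields an integer fraction `a / b` close to `w`,
which forces `v` either to have a large denominator or to be `w + Ψ d`, of denominator at least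
`1 / Ψ d`; in the second case the lower bound on `ω` makes the `Ψ`-neighbourhood of `v` short. As
`∑ q * Ψ q` converges, the neighbourhoods of all rationals of denominator at least `d` therefore
cover only a small proportion of the interval, and what remains contains, for every large `X`, about
`X ^ 2 * Ψ d * ω d` rationals of denominator comparable to `X` and of the same kind as `w`.
Iterating gives a Cantor subset of `exactSet Ψ ω`, and the mass distribution principle bounds its
dimension below by every `s` for which `q ^ 2 * (Ψ q * ω q) ^ s` is unbounded.
-/

/-- Positive functions on `(0, ∞)` for which `q ↦ q ^ 2 * f q` is non-increasing; both `Ψ` and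
`Ψ ω` are of this kind. -/
structure QuadraticDecay (f : ℝ → ℝ) : Prop where
  pos : ∀ q : ℝ, 0 < q → 0 < f q
  sq_mul_antitoneOn : AntitoneOn (fun q : ℝ => q ^ 2 * f q) (Ioi 0)

namespace QuadraticDecay

variable {f : ℝ → ℝ}

lemma sq_mul_le (hf : QuadraticDecay f) {a b : ℝ} (ha : 0 < a) (hab : a ≤ b) :
    b ^ 2 * f b ≤ a ^ 2 * f a :=
  hf.sq_mul_antitoneOn ha (ha.trans_le hab) hab

lemma le_of_le (hf : QuadraticDecay f) {a b : ℝ} (ha : 0 < a) (hab : a ≤ b) : f b ≤ f a := by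
  refine le_of_mul_le_mul_left ((hf.sq_mul_le ha hab).trans' ?_) (pow_pos ha 2)
  have := (hf.pos b (ha.trans_le hab)).le
  gcongr

lemma antitoneOn (hf : QuadraticDecay f) : AntitoneOn f (Ioi 0) :=
  fun _ ha _ _ hab => hf.le_of_le ha hab

lemma le_const_div_sq (hf : QuadraticDecay f) {q : ℝ} (hq : 1 ≤ q) : f q ≤ f 1 / q ^ 2 := by
  rw [le_div_iff₀ (by positivity), mul_comm]
  simpa using hf.sq_mul_le one_pos hq

lemma tendsto_zero (hf : QuadraticDecay f) : Tendsto f atTop (𝓝 0) := by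
  refine squeeze_zero' ?_ ?_ ((tendsto_pow_atTop two_ne_zero).const_div_atTop (f 1))
  · filter_upwards [eventually_gt_atTop 0] with q hq using (hf.pos q hq).le
  · filter_upwards [eventually_ge_atTop 1] with q hq using hf.le_const_div_sq hq

lemma summable_condensed (hf : QuadraticDecay f) (hsum : Summable fun q : ℕ => (q : ℝ) * f q) :
    Summable fun k : ℕ => 4 ^ k * f (2 ^ k) := by
  have hnonneg (n : ℕ) : 0 ≤ (n : ℝ) * f n := by
    rcases n.eq_zero_or_pos with rfl | hn
    · simp
    · exact mul_nonneg n.cast_nonneg (hf.pos _ (Nat.cast_pos.2 hn)).le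
  have hanti (m n : ℕ) (hm : 0 < m) (hmn : m ≤ n) : (n : ℝ) * f n ≤ m * f m := by
    have hm₀ : (0 : ℝ) < m := Nat.cast_pos.2 hm
    have hmn' : (m : ℝ) ≤ n := Nat.cast_le.2 hmn
    refine le_of_mul_le_mul_left ?_ hm₀
    calc (m : ℝ) * (n * f n) ≤ n * (n * f n) := by gcongr; exact hnonneg n
      _ = n ^ 2 * f n := by ring
      _ ≤ m ^ 2 * f m := hf.sq_mul_le hm₀ hmn'
      _ = m * (m * f m) := by ring
  refine ((summable_condensed_iff_of_nonneg hnonneg hanti).2 hsum).congr fun k => ?_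
  push_cast
  rw [← mul_assoc, ← mul_pow]
  norm_num

lemma eventually_sq_mul_le (hf : QuadraticDecay f) (hsum : Summable fun q : ℕ => (q : ℝ) * f q)
    {ε : ℝ} (hε : 0 < ε) : ∀ᶠ q : ℝ in atTop, q ^ 2 * f q ≤ ε := by
  obtain ⟨k, hk⟩ :=
    ((hf.summable_condensed hsum).tendsto_atTop_zero.eventually (eventually_le_nhds hε)).exists
  filter_upwards [eventually_ge_atTop ((2 : ℝ) ^ k)] with q hq
  refine (hf.sq_mul_le (by positivity) hq).trans (le_trans (le_of_eq ?_) hk)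
  rw [← pow_mul, mul_comm k, pow_mul]
  norm_num

lemma eventually_mul_apply_inv_le (hf : QuadraticDecay f)
    (hsum : Summable fun q : ℕ => (q : ℝ) * f q) : ∀ᶠ q : ℝ in atTop, 40 * f (f q)⁻¹ ≤ f q := by
  filter_upwards [hf.eventually_sq_mul_le hsum (show (0 : ℝ) < 1 / 40 by norm_num),
    eventually_ge_atTop 1] with q hsq hq
  have hq₀ : 0 < q := one_pos.trans_le hq
  have hfq := hf.pos q hq₀
  have hle_one : f q ≤ 1 := by linarith [le_mul_of_one_le_left hfq.le (one_le_pow₀ hq (n := 2))]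
  have hle_inv : q ≤ (f q)⁻¹ := by
    rw [le_inv_comm₀ hq₀ hfq, inv_eq_one_div, le_div_iff₀ hq₀]
    linarith [mul_le_mul_of_nonneg_left hq (mul_pos hq₀ hfq).le]
  have hinv := (hf.sq_mul_le hq₀ hle_inv).trans hsq
  rw [inv_pow, inv_mul_le_iff₀ (by positivity)] at hinv
  linarith [mul_le_of_le_one_left hfq.le hle_one, sq (f q)]

lemma mul_apply_inv_le (hf : QuadraticDecay f) {q : ℝ} (hq : 0 < f q) :
    64 * f (f q)⁻¹ ≤ f (1 / (8 * f q)) := by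
  have hle := hf.sq_mul_le (show 0 < 1 / (8 * f q) by positivity)
    (show 1 / (8 * f q) ≤ (f q)⁻¹ by
      rw [← one_div]
      gcongr
      linarith)
  refine le_of_mul_le_mul_left (hle.trans' (le_of_eq ?_))
    (show 0 < (1 / (8 * f q)) ^ 2 by positivity)
  field_simp
  norm_num

end QuadraticDecay

section ConvergenceExponent

variable {f : ℝ → ℝ}

lemma summable_mul_rpow_of_lt_liminf (hf : ∀ q : ℝ, 0 < q → 0 < f q) {s μ : ℝ} (hs : 0 ≤ s)
    (hμ : (μ : EReal) <
      liminf (fun q : ℝ => ((-Real.log (f q) / Real.log q : ℝ) : EReal)) atTop)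
    (hsμ : 2 < s * μ) : Summable fun q : ℕ => (q : ℝ) * f q ^ s := by
  have hlarge : ∀ᶠ q : ℝ in atTop,
      (μ : EReal) < ((-Real.log (f q) / Real.log q : ℝ) : EReal) ∧ 1 < q :=
    (eventually_lt_of_lt_liminf hμ).and (eventually_gt_atTop 1)
  have hsum : Summable fun n : ℕ => (n : ℝ) ^ (1 - s * μ) :=
    Real.summable_nat_rpow.2 (by linarith)
  refine hsum.of_norm_bounded_eventually_nat ?_
  filter_upwards [tendsto_natCast_atTop_atTop.eventually hlarge] with n ⟨hμn, hn⟩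
  have hn0 : (0 : ℝ) < n := zero_lt_one.trans hn
  have hfn := hf n hn0
  have hle : f n ≤ (n : ℝ) ^ (-μ) := by
    rw [EReal.coe_lt_coe_iff, lt_div_iff₀ (Real.log_pos hn)] at hμn
    rw [Real.rpow_def_of_pos hn0, ← Real.log_le_iff_le_exp hfn]
    linarith
  rw [Real.norm_of_nonneg (by positivity)]
  calc (n : ℝ) * f n ^ s ≤ n * ((n : ℝ) ^ (-μ)) ^ s := by gcongr
    _ = (n : ℝ) ^ (1 - s * μ) := by
      rw [← Real.rpow_mul hn0.le, sub_eq_add_neg, Real.rpow_add hn0, Real.rpow_one,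
        neg_mul, mul_comm μ]

lemma sq_mul_rpow_le_tsum (hf : ∀ q : ℝ, 0 < q → 0 < f q) (hf_anti : AntitoneOn f (Ioi 0))
    {s : ℝ} (hs : 0 ≤ s) (hsum : Summable fun q : ℕ => (q : ℝ) * f q ^ s) {q : ℝ} (hq : 1 ≤ q) :
    q ^ 2 * f q ^ s ≤ 4 * ∑' k : ℕ, (k : ℝ) * f k ^ s := by
  have hq0 : 0 < q := one_pos.trans_le hq
  have hfq := hf q hq0
  have hterm : ∀ k : ℕ, 0 ≤ (k : ℝ) * f k ^ s := fun k => by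
    rcases k.eq_zero_or_pos with rfl | hk
    · simp
    · have := hf k (by positivity)
      positivity
  have hgauss : q ^ 2 / 4 ≤ ∑ k ∈ Finset.range (⌊q⌋₊ + 1), (k : ℝ) := by
    have hcast : (∑ k ∈ Finset.range (⌊q⌋₊ + 1), (k : ℝ)) * 2 = (⌊q⌋₊ + 1) * ⌊q⌋₊ := by
      have := Finset.sum_range_id_mul_two (⌊q⌋₊ + 1)
      rw [Nat.add_sub_cancel] at this
      rw [← Nat.cast_sum]
      exact_mod_cast this
    have hfloor : (1 : ℝ) ≤ ⌊q⌋₊ := by exact_mod_cast Nat.le_floor (by simpa using hq)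
    nlinarith [Nat.lt_floor_add_one q]
  calc q ^ 2 * f q ^ s = 4 * (q ^ 2 / 4 * f q ^ s) := by ring
    _ ≤ 4 * ∑ k ∈ Finset.range (⌊q⌋₊ + 1), (k : ℝ) * f q ^ s := by
      rw [← Finset.sum_mul]
      gcongr
    _ ≤ 4 * ∑ k ∈ Finset.range (⌊q⌋₊ + 1), (k : ℝ) * f k ^ s := by
      gcongr 4 * ?_
      refine Finset.sum_le_sum fun k hk => ?_
      rcases k.eq_zero_or_pos with rfl | hk0
      · simp
      have hk0' : (0 : ℝ) < k := by exact_mod_cast hk0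
      have hkq : (k : ℝ) ≤ q :=
        (Nat.le_floor_iff hq0.le).1 (Nat.lt_succ_iff.1 (Finset.mem_range.1 hk))
      have := hf_anti hk0' hq0 hkq
      gcongr
    _ ≤ 4 * ∑' k : ℕ, (k : ℝ) * f k ^ s := by
      gcongr
      exact hsum.sum_le_tsum _ fun k _ => hterm k

lemma not_summable_mul_rpow_of_liminf_lt (hf : ∀ q : ℝ, 0 < q → 0 < f q)
    (hf_anti : AntitoneOn f (Ioi 0)) {s μ : ℝ} (hs : 0 ≤ s)
    (hμ : liminf (fun q : ℝ => ((-Real.log (f q) / Real.log q : ℝ) : EReal)) atTop < μ)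
    (hsμ : s * μ < 2) : ¬ Summable fun q : ℕ => (q : ℝ) * f q ^ s := by
  intro hsum
  have hunbounded : Tendsto (fun q : ℝ => q ^ (2 - s * μ)) atTop atTop :=
    tendsto_rpow_atTop (by linarith)
  obtain ⟨q, hqμ, hq_large, hq1⟩ :=
    ((frequently_lt_of_liminf_lt (by isBoundedDefault) hμ).and_eventually
      ((hunbounded.eventually_gt_atTop (4 * ∑' k : ℕ, (k : ℝ) * f k ^ s)).and
        (eventually_gt_atTop 1))).exists
  have hq0 : 0 < q := one_pos.trans hq1
  refine (sq_mul_rpow_le_tsum hf hf_anti hs hsum hq1.le).not_gt (hq_large.trans_le ?_)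
  have hge : q ^ (-μ) ≤ f q := by
    rw [EReal.coe_lt_coe_iff, div_lt_iff₀ (Real.log_pos hq1)] at hqμ
    rw [Real.rpow_def_of_pos hq0, ← Real.le_log_iff_exp_le (hf q hq0)]
    linarith
  calc q ^ (2 - s * μ) = q ^ 2 * (q ^ (-μ)) ^ s := by
        rw [← Real.rpow_mul hq0.le, ← Real.rpow_natCast q 2, ← Real.rpow_add hq0]
        congr 1
        push_cast
        ring
    _ ≤ q ^ 2 * f q ^ s := by gcongr

variable {Ψ ω : ℝ → ℝ}

lemma convergenceExponent_le_of_summable {s : ℝ≥0}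
    (hs : Summable fun q : ℕ => (q : ℝ) * (Ψ q * ω q) ^ (s : ℝ)) :
    convergenceExponent Ψ ω ≤ s :=
  sInf_le ⟨s, rfl, hs⟩

lemma convergenceExponent_le_of_div_lt_lowerOrder (hf : ∀ q : ℝ, 0 < q → 0 < Ψ q * ω q) {s : ℝ≥0}
    (hs : 0 < s) (hlt : ((2 / s : ℝ) : EReal) < lowerOrder Ψ ω) : convergenceExponent Ψ ω ≤ s := by
  obtain ⟨μ, hsμ, hμ⟩ := EReal.exists_between_coe_real hlt
  have hs' : (0 : ℝ) < s := hs
  refine convergenceExponent_le_of_summable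
    (summable_mul_rpow_of_lt_liminf (f := fun q => Ψ q * ω q) hf s.2 hμ ?_)
  rwa [EReal.coe_lt_coe_iff, div_lt_iff₀' hs'] at hsμ

lemma le_convergenceExponent_of_lowerOrder_lt_div (hf : QuadraticDecay fun q => Ψ q * ω q)
    {s : ℝ≥0} (hlt : lowerOrder Ψ ω < ((2 / s : ℝ) : EReal)) :
    s ≤ convergenceExponent Ψ ω := by
  obtain ⟨μ, hμ, hsμ⟩ := EReal.exists_between_coe_real hlt
  rw [EReal.coe_lt_coe_iff] at hsμ
  refine le_sInf ?_
  rintro _ ⟨t, rfl, ht⟩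
  by_contra! hts
  have hts' : (t : ℝ) < s := by exact_mod_cast hts
  have hs0 : (0 : ℝ) < s := t.2.trans_lt hts'
  rw [lt_div_iff₀' hs0] at hsμ
  refine not_summable_mul_rpow_of_liminf_lt hf.pos hf.antitoneOn t.2 hμ ?_ ht
  rcases le_total μ 0 with hμ0 | hμ0
  · linarith [mul_nonpos_of_nonneg_of_nonpos t.2 hμ0]
  · exact (mul_le_mul_of_nonneg_right hts'.le hμ0).trans_lt hsμ

lemma one_le_lowerOrder (hf : QuadraticDecay fun q => Ψ q * ω q) : 1 ≤ lowerOrder Ψ ω := by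
  refine le_liminf_of_le (by isBoundedDefault) ?_
  filter_upwards [eventually_gt_atTop (1 : ℝ), eventually_ge_atTop (Ψ 1 * ω 1)] with q hq hq'
  have hq0 : 0 < q := one_pos.trans hq
  have hle : Ψ q * ω q ≤ q⁻¹ := calc
    Ψ q * ω q ≤ Ψ 1 * ω 1 / q ^ 2 := hf.le_const_div_sq hq.le
    _ ≤ q / q ^ 2 := by gcongr
    _ = q⁻¹ := by field_simp
  have hlog := Real.log_le_log (hf.pos q hq0) hle
  rw [Real.log_inv] at hlog
  have : (1 : ℝ) ≤ -Real.log (Ψ q * ω q) / Real.log q :=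
    (one_le_div (Real.log_pos hq)).2 (by linarith)
  exact_mod_cast this

theorem convergenceExponent_eq_two_div_lowerOrder (hf : QuadraticDecay fun q => Ψ q * ω q) :
    ((convergenceExponent Ψ ω : ℝ≥0∞) : EReal) = 2 / lowerOrder Ψ ω := by
  have hone := one_le_lowerOrder hf
  induction hl : lowerOrder Ψ ω with
  | bot => exact absurd (hl ▸ hone) (by decide)
  | top =>
    have hzero : convergenceExponent Ψ ω = 0 := by
      refine le_antisymm (ENNReal.le_of_forall_pos_le_add fun ε hε _ => ?_) bot_le
      rw [zero_add]
      exact convergenceExponent_le_of_div_lt_lowerOrder hf.pos hε (hl ▸ EReal.coe_lt_top _)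
    simp [hzero]
  | coe r =>
    have hr : 0 < r := one_pos.trans_le (by rw [hl] at hone; exact_mod_cast hone)
    lift r to ℝ≥0 using hr.le
    have hr' : 0 < r := hr
    have hfin : convergenceExponent Ψ ω = ((2 / r : ℝ≥0) : ℝ≥0∞) := by
      refine le_antisymm (ENNReal.le_of_forall_pos_le_add fun ε hε _ => ?_)
        (ENNReal.le_of_forall_nnreal_lt fun s hs => ?_)
      · refine convergenceExponent_le_of_div_lt_lowerOrder (s := 2 / r + ε) hf.pos
          (add_pos_of_nonneg_of_pos bot_le hε) ?_
        rw [hl, EReal.coe_lt_coe_iff]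
        have : 2 / (2 / r + ε) < r := by
          rw [div_lt_comm₀ (by positivity) hr']
          exact lt_add_of_pos_right _ hε
        exact_mod_cast this
      · rcases eq_zero_or_pos s with rfl | hs0
        · exact bot_le
        refine le_convergenceExponent_of_lowerOrder_lt_div hf ?_
        rw [hl, EReal.coe_lt_coe_iff]
        have : r < 2 / s := (lt_div_comm₀ hs0 hr').1 (by exact_mod_cast hs)
        exact_mod_cast this
    rw [hfin]
    norm_cast

lemma convergenceExponent_le_of_le_mul {ω' : ℝ → ℝ} {C : ℝ}
    (hpos : ∀ q : ℕ, 0 < q → 0 ≤ Ψ q * ω q) (hpos' : ∀ q : ℕ, 0 < q → 0 ≤ Ψ q * ω' q)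
    (hle : ∀ q : ℕ, 0 < q → Ψ q * ω q ≤ C * (Ψ q * ω' q)) :
    convergenceExponent Ψ ω ≤ convergenceExponent Ψ ω' := by
  refine le_sInf ?_
  rintro _ ⟨s, rfl, hs⟩
  refine convergenceExponent_le_of_summable
    ((hs.mul_left (|C| ^ (s : ℝ))).of_nonneg_of_le (fun q => ?_) fun q => ?_) <;>
  rcases q.eq_zero_or_pos with rfl | hq
  · simp
  · exact mul_nonneg q.cast_nonneg (Real.rpow_nonneg (hpos q hq) _)
  · simp
  · have := hpos q hq
    have := hpos' q hq
    calc (q : ℝ) * (Ψ q * ω q) ^ (s : ℝ) ≤ q * (|C| * (Ψ q * ω' q)) ^ (s : ℝ) := by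
          have hle_abs : Ψ q * ω q ≤ |C| * (Ψ q * ω' q) :=
            (hle q hq).trans (mul_le_mul_of_nonneg_right (le_abs_self C) this)
          exact mul_le_mul_of_nonneg_left (Real.rpow_le_rpow (hpos q hq) hle_abs s.2) q.cast_nonneg
      _ = |C| ^ (s : ℝ) * (q * (Ψ q * ω' q) ^ (s : ℝ)) := by
          rw [Real.mul_rpow (abs_nonneg C) this]
          ring

lemma convergenceExponent_le_one (hf : QuadraticDecay fun q => Ψ q * ω q) :
    convergenceExponent Ψ ω ≤ 1 := by
  refine ENNReal.le_of_forall_pos_le_add fun ε hε _ => ?_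
  refine convergenceExponent_le_of_summable (s := 1 + ε) ?_
  have hsum : Summable fun q : ℕ => (Ψ 1 * ω 1) ^ (1 + ε : ℝ) * (q : ℝ) ^ (1 - 2 * (1 + ε : ℝ)) :=
    (Real.summable_nat_rpow.2 (by linarith)).mul_left _
  refine hsum.of_norm_bounded_eventually_nat ?_
  filter_upwards [eventually_ge_atTop 1] with q hq
  have hq1 : (1 : ℝ) ≤ q := by exact_mod_cast hq
  have hq0 : (0 : ℝ) < q := one_pos.trans_le hq1
  have hfq := hf.pos q hq0
  have hf1 := hf.pos 1 one_pos
  rw [Real.norm_of_nonneg (by positivity)]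
  push_cast
  calc (q : ℝ) * (Ψ q * ω q) ^ (1 + ε : ℝ) ≤ q * (Ψ 1 * ω 1 / (q : ℝ) ^ 2) ^ (1 + ε : ℝ) := by
        gcongr
        exact hf.le_const_div_sq hq1
    _ = (Ψ 1 * ω 1) ^ (1 + ε : ℝ) * (q : ℝ) ^ (1 - 2 * (1 + ε : ℝ)) := by
        rw [Real.div_rpow hf1.le (by positivity), ← Real.rpow_natCast, ← Real.rpow_mul hq0.le,
          Real.rpow_sub hq0, Real.rpow_one]
        push_cast
        ring

lemma frequently_le_sq_mul_rpow (hf : ∀ q : ℕ, 0 < q → 0 < Ψ q * ω q) {s : ℝ} (hs : 0 < s)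
    (hlt : ENNReal.ofReal s < convergenceExponent Ψ ω) (M : ℝ) :
    ∃ᶠ n : ℕ in atTop, M ≤ (n : ℝ) ^ 2 * (Ψ n * ω n) ^ s := by
  intro hcon
  obtain ⟨t, hst, hlt⟩ := ENNReal.lt_iff_exists_nnreal_btwn.1 hlt
  refine hlt.not_ge (convergenceExponent_le_of_summable ?_)
  have hst : 1 < t / s :=
    (one_lt_div hs).2 ((ENNReal.ofReal_lt_coe_iff (hs.le)).1 hst)
  have hsum : Summable fun n : ℕ => M ^ (t / s : ℝ) * (n : ℝ) ^ (1 - 2 * (t / s)) :=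
    (Real.summable_nat_rpow.2 (by linarith)).mul_left _
  refine hsum.of_norm_bounded_eventually_nat ?_
  filter_upwards [hcon, eventually_ge_atTop 1] with n hn hn1
  have hn0 : (0 : ℝ) < n := by exact_mod_cast hn1
  have hfn := hf n hn1
  have hM : 0 < M := (not_le.1 hn).trans' (by positivity)
  rw [Real.norm_of_nonneg (by positivity)]
  calc (n : ℝ) * (Ψ n * ω n) ^ (t : ℝ) = n * ((Ψ n * ω n) ^ s) ^ (t / s : ℝ) := by
        rw [← Real.rpow_mul hfn.le, mul_div_cancel₀ _ hs.ne']
    _ ≤ n * (M / (n : ℝ) ^ 2) ^ (t / s : ℝ) := by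
        gcongr
        rw [le_div_iff₀' (by positivity)]
        exact (not_le.1 hn).le
    _ = M ^ (t / s : ℝ) * (n : ℝ) ^ (1 - 2 * (t / s : ℝ)) := by
        rw [Real.div_rpow hM.le (by positivity), ← Real.rpow_natCast, ← Real.rpow_mul hn0.le,
          Real.rpow_sub hn0, Real.rpow_one]
        push_cast
        ring

end ConvergenceExponent

section UpperBound

open MeasureTheory

lemma dimH_setOf_frequently_mem_le {X ι : Type*} [EMetricSpace X] [Countable ι] {A : ι → Set X}
    {s : ℝ≥0} (hs : 0 < s) (hA : ∑' i, Metric.ediam (A i) ^ (s : ℝ) ≠ ⊤) :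
    dimH {x | ∃ᶠ i in cofinite, x ∈ A i} ≤ s := by
  borelize X
  have htail := ENNReal.tendsto_tsum_compl_atTop_zero hA
  have hs' : (0 : ℝ) < s := hs
  have hdiam : Tendsto (fun F : Finset ι =>
      (∑' i : {i // i ∉ F}, Metric.ediam (A i) ^ (s : ℝ)) ^ (s⁻¹ : ℝ)) atTop (𝓝 0) := by
    simpa [hs'] using htail.ennrpow_const (s⁻¹ : ℝ)
  refine dimH_le_of_hausdorffMeasure_ne_top (ne_top_of_le_ne_top ENNReal.zero_ne_top ?_)
  refine (Measure.hausdorffMeasure_le_liminf_tsum s _ _ hdiam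
    (fun (F : Finset ι) (i : {i // i ∉ F}) => A i)
    (Eventually.of_forall fun F i => ?_) (Eventually.of_forall fun F x hx => ?_)).trans
      htail.liminf_eq.le
  · rw [ENNReal.le_rpow_inv_iff hs']
    exact ENNReal.le_tsum (f := fun i : {i // i ∉ F} => Metric.ediam (A i) ^ (s : ℝ)) i
  · obtain ⟨i, hxi, hiF⟩ := (Frequently.and_eventually hx F.eventually_cofinite_notMem).exists
    exact mem_iUnion.2 ⟨⟨i, hiF⟩, hxi⟩

/-- The upper limit of the intervals `[p / q + lo q, p / q + lo q + g q]`, taken over the fractions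
`p / q` in `[N - 1, N + 2)`; for `q = 0` this window of numerators is empty. -/
def limsupIntervals (N : ℤ) (lo g : ℕ → ℝ) : Set ℝ :=
  {x : ℝ | ∃ᶠ r : ℤ × ℕ in cofinite, r.1 ∈ Finset.Ico ((N - 1) * r.2) ((N + 2) * r.2) ∧
    x ∈ Icc (r.1 / r.2 + lo r.2) (r.1 / r.2 + lo r.2 + g r.2)}

lemma dimH_limsupIntervals_le {g : ℕ → ℝ} (hg : ∀ q : ℕ, 0 < q → 0 ≤ g q) {s : ℝ≥0}
    (hs : 0 < s) (hsum : Summable fun q : ℕ => (q : ℝ) * g q ^ (s : ℝ)) (N : ℤ) (lo : ℕ → ℝ) :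
    dimH (limsupIntervals N lo g) ≤ s := by
  refine dimH_setOf_frequently_mem_le (A := fun r : ℤ × ℕ =>
    {x | r.1 ∈ Finset.Ico ((N - 1) * r.2) ((N + 2) * r.2) ∧
      x ∈ Icc (r.1 / r.2 + lo r.2) (r.1 / r.2 + lo r.2 + g r.2)}) hs ?_
  have hs' : (0 : ℝ) < s := hs
  have hpiece : ∀ (p : ℤ) (q : ℕ), Metric.ediam {x : ℝ | p ∈ Finset.Ico ((N - 1) * q) ((N + 2) * q)
      ∧ x ∈ Icc (p / q + lo q) (p / q + lo q + g q)} ^ (s : ℝ) ≤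
      if p ∈ Finset.Ico ((N - 1) * q) ((N + 2) * q) then ENNReal.ofReal (g q ^ (s : ℝ)) else 0 := by
    intro p q
    split_ifs with hp
    · have hq : 0 < q := by
        rcases q.eq_zero_or_pos with rfl | hq
        · simp at hp
        · exact hq
      simp only [hp, true_and, ofPred_mem_eq, Real.ediam_Icc, add_sub_cancel_left]
      exact (ENNReal.ofReal_rpow_of_nonneg (hg q hq) s.2).le
    · simp [hp, hs']
  refine ne_top_of_le_ne_top (hsum.mul_left 3).tsum_ofReal_ne_top ?_
  calc _ = ∑' (q : ℕ) (p : ℤ), _ := by rw [ENNReal.tsum_prod', ENNReal.tsum_comm]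
    _ ≤ _ := ENNReal.tsum_le_tsum fun q => (ENNReal.tsum_le_tsum fun p => hpiece p q).trans ?_
  rw [tsum_eq_sum (s := Finset.Ico ((N - 1) * (q : ℤ)) ((N + 2) * q)) fun p hp => if_neg hp,
    Finset.sum_congr rfl fun p hp => if_pos hp, Finset.sum_const, Int.card_Ico, nsmul_eq_mul,
    show (N + 2) * q - (N - 1) * q = ((3 * q : ℕ) : ℤ) by push_cast; ring, Int.toNat_natCast,
    ← mul_assoc, ENNReal.ofReal_mul (by positivity)]
  gcongr
  exact (ENNReal.ofReal_natCast (3 * q)).symm.trans_le (by push_cast; rfl)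

lemma finite_setOf_abs_sub_int_div_le (x r : ℝ) {q : ℕ} (hq : 0 < q) :
    {p : ℤ | |x - p / q| ≤ r}.Finite := by
  refine (finite_Icc ⌊(x - r) * q⌋ ⌈(x + r) * q⌉).subset fun p (hp : |x - p / q| ≤ r) => ?_
  have hq' : (0 : ℝ) < q := by exact_mod_cast hq
  obtain ⟨hle, hge⟩ := abs_le.1 hp
  have hlower : (x - r) * q ≤ p := (le_div_iff₀ hq').1 (by linarith)
  have hupper : (p : ℝ) ≤ (x + r) * q := (div_le_iff₀ hq').1 (by linarith)
  exact ⟨by exact_mod_cast (Int.floor_le _).trans hlower,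
    by exact_mod_cast hupper.trans (Int.le_ceil _)⟩

variable {Ψ ω : ℝ → ℝ}

lemma frequently_abs_sub_le_of_mem_approximableSet {x : ℝ} (hx : x ∈ approximableSet Ψ)
    {P : ℕ → Prop} (hP : ∀ᶠ q in atTop, P q) :
    ∃ᶠ r : ℤ × ℕ in cofinite, 0 < r.2 ∧ |x - r.1 / r.2| ≤ Ψ r.2 ∧ P r.2 := by
  obtain ⟨M, hM⟩ := eventually_atTop.1 hP
  rw [frequently_cofinite_iff_infinite]
  intro hfin
  have hsmall : (⋃ q ∈ Finset.Ioo 0 M,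
      (fun p : ℤ => (p, q)) '' {p : ℤ | |x - p / q| ≤ Ψ q}).Finite :=
    (Finset.finite_toSet _).biUnion fun q hq =>
      (finite_setOf_abs_sub_int_div_le x (Ψ q) (Finset.mem_Ioo.1 hq).1).image _
  refine hx ((hfin.union hsmall).subset ?_)
  rintro ⟨p, q⟩ ⟨hq, hpq⟩
  rcases lt_or_ge q M with hqM | hqM
  · exact Or.inr (mem_biUnion (Finset.mem_Ioo.2 ⟨hq, hqM⟩) ⟨p, hpq, rfl⟩)
  · exact Or.inl ⟨hq, hpq, hM q hqM⟩

lemma mem_Ico_of_abs_sub_div_le {N p : ℤ} {q : ℕ} (hq : 0 < q) {x : ℝ}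
    (hx : x ∈ Ico (N : ℝ) (N + 1)) (hpq : |x - p / q| ≤ 1) :
    p ∈ Finset.Ico ((N - 1) * q) ((N + 2) * q) := by
  have hq' : (0 : ℝ) < q := by exact_mod_cast hq
  obtain ⟨hlower, hupper⟩ := abs_le.1 hpq
  have hp1 : ((N : ℝ) - 1) * q ≤ p := (le_div_iff₀ hq').1 (by linarith [hx.1])
  have hp2 : (p : ℝ) < (N + 2) * q := (div_lt_iff₀ hq').1 (by linarith [hx.2])
  exact Finset.mem_Ico.2 ⟨by exact_mod_cast hp1, by exact_mod_cast hp2⟩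

/- Near the fraction `p / q`, a point of the exact set lies in one of the two intervals of length
`Ψ q * ω q` at the ends of `[p / q - Ψ q, p / q + Ψ q]`. -/
lemma dimH_exactSet_le_of_summable (hpos : ∀ q : ℕ, 0 < q → 0 ≤ Ψ q * ω q)
    (hΨ : ∀ᶠ q : ℕ in atTop, Ψ q ≤ 1) {s : ℝ≥0} (hs : 0 < s)
    (hsum : Summable fun q : ℕ => (q : ℝ) * (Ψ q * ω q) ^ (s : ℝ)) :
    dimH (exactSet Ψ ω) ≤ s := by
  have hcover : exactSet Ψ ω ⊆ ⋃ N : ℤ,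
      limsupIntervals N (fun q => (1 - ω q) * Ψ q) (fun q => Ψ q * ω q) ∪
        limsupIntervals N (fun q => -Ψ q) (fun q => Ψ q * ω q) := by
    rintro x ⟨hx, hexact⟩
    refine mem_iUnion.2 ⟨⌊x⌋, ?_⟩
    simp only [limsupIntervals, mem_union, mem_ofPred_eq]
    rw [← Filter.frequently_or_distrib]
    refine (frequently_abs_sub_le_of_mem_approximableSet hx (hexact.and hΨ)).mono ?_
    rintro ⟨p, q⟩ ⟨hq, hpq, hlow, hΨq⟩
    have hwindow := mem_Ico_of_abs_sub_div_le hq ⟨Int.floor_le x, Int.lt_floor_add_one x⟩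
      (hpq.trans hΨq)
    have hlow := hlow p
    rcases le_total (p / q : ℝ) x with hle | hle
    · rw [abs_of_nonneg (sub_nonneg.2 hle)] at hpq hlow
      exact Or.inl ⟨hwindow, by linarith, by linarith⟩
    · rw [abs_of_nonpos (sub_nonpos.2 hle)] at hpq hlow
      exact Or.inr ⟨hwindow, by linarith, by linarith⟩
  refine (dimH_mono hcover).trans ?_
  rw [dimH_iUnion]
  refine iSup_le fun N => ?_
  rw [dimH_union]
  exact max_le (dimH_limsupIntervals_le hpos hs hsum N _) (dimH_limsupIntervals_le hpos hs hsum N _)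

lemma not_summable_natCast_mul_rpow_zero (f : ℕ → ℝ) :
    ¬ Summable fun q : ℕ => (q : ℝ) * f q ^ (0 : ℝ) := by
  intro hsum
  have := hsum.tendsto_atTop_zero
  simp only [Real.rpow_zero, mul_one] at this
  exact not_tendsto_nhds_of_tendsto_atTop tendsto_natCast_atTop_atTop _ this

theorem dimH_exactSet_le (hpos : ∀ q : ℕ, 0 < q → 0 ≤ Ψ q * ω q)
    (hΨ : ∀ᶠ q : ℕ in atTop, Ψ q ≤ 1) : dimH (exactSet Ψ ω) ≤ convergenceExponent Ψ ω := by
  refine le_sInf ?_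
  rintro _ ⟨s, rfl, hsum⟩
  refine dimH_exactSet_le_of_summable hpos hΨ (pos_iff_ne_zero.2 ?_) hsum
  rintro rfl
  exact not_summable_natCast_mul_rpow_zero (fun q => Ψ q * ω q) hsum

end UpperBound

section MassDistribution

open MeasureTheory

/- An outer measure suffices here, so no coding map ever has to be shown measurable. -/
theorem le_dimH_of_outerMeasure_le {X : Type*} [MetricSpace X] (μ : OuterMeasure X) {E : Set X}
    {s : ℝ≥0} (hs : 0 < s) {C r₀ : ℝ} (hr₀ : 0 < r₀)
    (hμ : ∀ (U : Set X) (r : ℝ), 0 < r → r < r₀ → (∀ x ∈ U, ∀ y ∈ U, dist x y ≤ r) →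
      μ U ≤ ENNReal.ofReal (C * r ^ (s : ℝ))) (hE : μ E ≠ 0) : s ≤ dimH E := by
  borelize X
  have hs' : (0 : ℝ) < s := hs
  have hdiam : ∀ U : Set X, Metric.ediam U ≤ ENNReal.ofReal (r₀ / 2) →
      μ U ≤ ENNReal.ofReal C * Metric.ediam U ^ (s : ℝ) := by
    intro U hU
    have hfin : Metric.ediam U ≠ ⊤ := ne_top_of_le_ne_top ENNReal.ofReal_ne_top hU
    have hr : Metric.diam U < r₀ :=
      (ENNReal.toReal_le_of_le_ofReal (by positivity) hU).trans_lt (half_lt_self hr₀)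
    have hlim : Tendsto (fun r : ℝ => ENNReal.ofReal (C * r ^ (s : ℝ))) (𝓝[>] Metric.diam U)
        (𝓝 (ENNReal.ofReal (C * Metric.diam U ^ (s : ℝ)))) :=
      ENNReal.tendsto_ofReal (((Real.continuousAt_rpow_const _ _ (Or.inr hs'.le)).tendsto.mono_left
        nhdsWithin_le_nhds).const_mul C)
    have hle : μ U ≤ ENNReal.ofReal (C * Metric.diam U ^ (s : ℝ)) := by
      refine ge_of_tendsto hlim ?_
      filter_upwards [Ioo_mem_nhdsGT hr] with r ⟨hUr, hr₀⟩
      exact hμ U r (Metric.diam_nonneg.trans_lt hUr) hr₀ fun x hx y hy =>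
        (Metric.dist_le_diam_of_mem' hfin hx hy).trans hUr.le
    rwa [ENNReal.ofReal_mul' (by positivity), ← ENNReal.ofReal_rpow_of_nonneg Metric.diam_nonneg
      hs'.le, Metric.diam, ENNReal.ofReal_toReal hfin] at hle
  have hmetric : μ ≤ (Measure.mkMetric fun d => ENNReal.ofReal C * d ^ (s : ℝ)).toOuterMeasure := by
    rw [Measure.mkMetric_toOuterMeasure]
    exact OuterMeasure.le_mkMetric _ _ _ (ENNReal.ofReal_pos.2 (half_pos hr₀)) hdiam
  have hhausdorff : (Measure.mkMetric fun d => ENNReal.ofReal C * d ^ (s : ℝ)) ≤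
      (ENNReal.ofReal C + 1) • (Measure.hausdorffMeasure s : Measure X) := by
    refine Measure.mkMetric_mono_smul (by simp) (by simp) (Eventually.of_forall fun d => ?_)
    simp only [Pi.smul_apply, smul_eq_mul]
    gcongr
    exact le_self_add
  refine le_dimH_of_hausdorffMeasure_ne_zero fun hzero => hE (nonpos_iff_eq_zero.1 ?_)
  calc μ E ≤ ((ENNReal.ofReal C + 1) • (Measure.hausdorffMeasure s : Measure X)) E :=
        (hmetric E).trans (hhausdorff E)
    _ = 0 := by simp [hzero]

lemma card_le_of_separated {ι : Type*} {F : Finset ι} {f : ι → ℝ} {δ l : ℝ} (hδ : 0 < δ)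
    (hl : 0 ≤ l) (hdiam : ∀ i ∈ F, ∀ j ∈ F, |f i - f j| ≤ l)
    (hsep : ∀ i ∈ F, ∀ j ∈ F, i ≠ j → δ ≤ |f i - f j|) : (F.card : ℝ) ≤ l / δ + 1 := by
  rcases F.eq_empty_or_nonempty with rfl | hF
  · rw [Finset.card_empty, Nat.cast_zero]
    positivity
  obtain ⟨m, hmF, hm⟩ := F.exists_min_image f hF
  have hcard : F.card ≤ (Finset.range (⌊l / δ⌋₊ + 1)).card := by
    refine Finset.card_le_card_of_injOn (fun i => ⌊(f i - f m) / δ⌋₊) (fun i hi => ?_) ?_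
    · simp only [Finset.coe_range, mem_Iio, Nat.lt_succ_iff]
      exact Nat.floor_le_floor (by gcongr; exact (le_abs_self _).trans (hdiam i hi m hmF))
    · intro i hi j hj hij
      by_contra hne
      have hnonneg : ∀ k ∈ F, 0 ≤ (f k - f m) / δ := fun k hk =>
        div_nonneg (sub_nonneg.2 (hm k hk)) hδ.le
      have hclose : |(f i - f m) / δ - (f j - f m) / δ| < 1 := by
        apply Int.abs_sub_lt_one_of_floor_eq_floor
        rw [← Int.natCast_floor_eq_floor (hnonneg i hi),
          ← Int.natCast_floor_eq_floor (hnonneg j hj)]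
        exact_mod_cast hij
      rw [← sub_div, sub_sub_sub_cancel_right, abs_div, abs_of_pos hδ, div_lt_one hδ] at hclose
      exact (hsep i hi j hj hne).not_gt hclose
  rw [Finset.card_range] at hcard
  calc (F.card : ℝ) ≤ ⌊l / δ⌋₊ + 1 := by exact_mod_cast hcard
    _ ≤ l / δ + 1 := by gcongr; exact Nat.floor_le (by positivity)

end MassDistribution

section Trees

open MeasureTheory

variable {n : ℕ → ℕ}

/-- The node of level `k` on the branch `a` of the tree with root `u₀` in which the children of a
node `u` of level `k` are `child k u j`. -/
def treeNode {α : Type*} (u₀ : α) (child : ∀ k, α → Fin (n k) → α) (a : ∀ k, Fin (n k)) : ℕ → α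
  | 0 => u₀
  | k + 1 => child k (treeNode u₀ child a k) (a k)

lemma treeNode_congr {α : Type*} {u₀ : α} {child : ∀ k, α → Fin (n k) → α} {a b : ∀ k, Fin (n k)}
    {k : ℕ} (hab : ∀ i < k, a i = b i) : treeNode u₀ child a k = treeNode u₀ child b k := by
  induction k with
  | zero => rfl
  | succ k ih =>
    rw [treeNode, treeNode, ih fun i hi => hab i (hi.trans k.lt_succ_self), hab k k.lt_succ_self]

variable [∀ k, NeZero (n k)]

variable (n) in
/-- The uniform probability measure on the infinite branches of a tree whose nodes of level `k`
have `n k` children; branches are coded by the index of the child chosen at each level. -/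
noncomputable def branchMeasure : Measure (∀ k, Fin (n k)) :=
  Measure.infinitePi fun _ => ProbabilityTheory.uniformOn univ

instance : ∀ k, IsProbabilityMeasure (ProbabilityTheory.uniformOn (univ : Set (Fin (n k)))) :=
  fun _ => ProbabilityTheory.isProbabilityMeasure_uniformOn finite_univ univ_nonempty

instance : IsProbabilityMeasure (branchMeasure n) :=
  inferInstanceAs (IsProbabilityMeasure (Measure.infinitePi _))

lemma branchMeasure_cylinder (k : ℕ) (a : ∀ k, Fin (n k)) :
    branchMeasure n {b | ∀ i < k, b i = a i} =
      ENNReal.ofReal (∏ i ∈ Finset.range k, (n i : ℝ)⁻¹) := by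
  have hcyl : {b : ∀ k, Fin (n k) | ∀ i < k, b i = a i} =
      (Finset.range k : Set ℕ).pi fun i => {a i} := by
    ext b
    simp [Set.mem_pi]
  rw [hcyl, branchMeasure, Measure.infinitePi_pi _ fun i _ => measurableSet_singleton _,
    ENNReal.ofReal_prod_of_nonneg fun i _ => by positivity]
  refine Finset.prod_congr rfl fun i _ => ?_
  rw [ProbabilityTheory.uniformOn_univ, Measure.count_singleton, Fintype.card_fin, one_div,
    ENNReal.ofReal_inv_of_pos (by exact_mod_cast NeZero.pos (n i)), ENNReal.ofReal_natCast]

variable {φ : (∀ k, Fin (n k)) → ℝ} {k : ℕ} {δ r : ℝ} {U : Set ℝ}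

lemma branchMeasure_preimage_le_of_lt
    (hsep : ∀ a b, (∃ i < k, a i ≠ b i) → δ ≤ |φ a - φ b|) (hr : r < δ)
    (hU : ∀ x ∈ U, ∀ y ∈ U, |x - y| ≤ r) :
    branchMeasure n (φ ⁻¹' U) ≤ ENNReal.ofReal (∏ i ∈ Finset.range k, (n i : ℝ)⁻¹) := by
  rcases (φ ⁻¹' U).eq_empty_or_nonempty with hempty | ⟨a, ha⟩
  · simp [hempty]
  rw [← branchMeasure_cylinder k a]
  refine measure_mono fun b hb => ?_
  by_contra! hba
  exact ((hsep b a (by simpa using hba)).trans (hU _ hb _ ha)).not_gt hr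

lemma branchMeasure_preimage_le (hδ : 0 < δ)
    (hsep : ∀ a b, (∃ i < k, a i ≠ b i) → δ ≤ |φ a - φ b|) (hr : 0 ≤ r)
    (hU : ∀ x ∈ U, ∀ y ∈ U, |x - y| ≤ r) :
    branchMeasure n (φ ⁻¹' U) ≤
      ENNReal.ofReal ((r / δ + 1) * ∏ i ∈ Finset.range k, (n i : ℝ)⁻¹) := by
  let pre (a : ∀ k, Fin (n k)) (i : Fin k) : Fin (n i) := a i
  have hprefix : (pre '' (φ ⁻¹' U)).Finite := toFinite _
  choose! c hcU hc using fun (p : ∀ i : Fin k, Fin (n i)) (hp : p ∈ pre '' (φ ⁻¹' U)) => hp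
  have hcard : (hprefix.toFinset.card : ℝ) ≤ r / δ + 1 := by
    refine card_le_of_separated (f := fun p => φ (c p)) hδ hr ?_ ?_ <;>
    simp only [Finite.mem_toFinset] <;> intro p hp p' hp'
    · exact hU _ (hcU p hp) _ (hcU p' hp')
    · intro hne
      obtain ⟨i, hi⟩ := Function.ne_iff.1 hne
      refine hsep _ _ ⟨i, i.2, ?_⟩
      rwa [← hc p hp, ← hc p' hp'] at hi
  have hcover : φ ⁻¹' U ⊆ ⋃ p ∈ hprefix.toFinset, {b | ∀ i < k, b i = c p i} := fun b hb => by
    have hp : pre b ∈ pre '' (φ ⁻¹' U) := mem_image_of_mem pre hb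
    refine mem_biUnion (hprefix.mem_toFinset.2 hp) fun i hi => ?_
    exact congrFun (hc _ hp).symm ⟨i, hi⟩
  refine (measure_mono hcover).trans ((measure_biUnion_finset_le _ _).trans ?_)
  simp only [branchMeasure_cylinder, Finset.sum_const, nsmul_eq_mul]
  rw [ENNReal.ofReal_mul (by positivity)]
  gcongr
  rw [← ENNReal.ofReal_natCast]
  exact ENNReal.ofReal_le_ofReal hcard

lemma min_le_mul_rpow {m z s : ℝ} (hm : 0 ≤ m) (hz : 0 ≤ z) (hs₀ : 0 ≤ s) (hs₁ : s ≤ 1) :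
    min m (m * z) ≤ m * z ^ s := by
  rcases le_total z 1 with hz1 | hz1
  · exact (min_le_right _ _).trans
      (mul_le_mul_of_nonneg_left (Real.self_le_rpow_of_le_one hz hz1 hs₁) hm)
  · exact (min_le_left _ _).trans (le_mul_of_one_le_right hm (Real.one_le_rpow hz1 hs₀))

lemma exists_succ_le_lt_of_antitone {δ : ℕ → ℝ} (hanti : Antitone δ) (hδ₀ : Tendsto δ atTop (𝓝 0))
    {k₀ : ℕ} {r : ℝ} (hr : 0 < r) (hrδ : r < δ k₀) : ∃ k ≥ k₀, δ (k + 1) ≤ r ∧ r < δ k := by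
  classical
  have hex : ∃ k, δ k ≤ r := (hδ₀.eventually (eventually_le_nhds hr)).exists
  have hfind : k₀ < Nat.find hex := by
    by_contra! hle
    exact ((hanti hle).trans (Nat.find_spec hex)).not_gt hrδ
  obtain ⟨k, hk⟩ := Nat.exists_eq_succ_of_ne_zero (Nat.ne_zero_of_lt hfind)
  have hspec := Nat.find_spec hex
  rw [hk] at hspec
  exact ⟨k, by omega, hspec, not_le.1 (Nat.find_min hex (hk ▸ k.lt_succ_self))⟩

theorem le_dimH_range_of_separated {δ : ℕ → ℝ} (hδ : ∀ k, 0 < δ k) (hanti : Antitone δ)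
    (hδ₀ : Tendsto δ atTop (𝓝 0))
    (hsep : ∀ k a b, (∃ i < k, a i ≠ b i) → δ k ≤ |φ a - φ b|) {s : ℝ≥0} (hs₀ : 0 < s)
    (hs₁ : s ≤ 1) {A : ℝ}
    (hmass : ∀ᶠ k in atTop, ∏ i ∈ Finset.range k, (n i : ℝ)⁻¹ ≤ A * (n k * δ (k + 1)) ^ (s : ℝ)) :
    s ≤ dimH (range φ) := by
  obtain ⟨k₀, hk₀⟩ := eventually_atTop.1 hmass
  have hs₀' : (0 : ℝ) < s := hs₀
  refine le_dimH_of_outerMeasure_le (OuterMeasure.map φ (branchMeasure n).toOuterMeasure) hs₀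
    (C := A * 2 ^ (s : ℝ)) (hδ k₀) (fun U r hr hrδ hU => ?_) ?_
  · rw [OuterMeasure.map_apply]
    obtain ⟨k, hk, hspec, hlt⟩ := exists_succ_le_lt_of_antitone hanti hδ₀ hr hrδ
    set m := ∏ i ∈ Finset.range k, (n i : ℝ)⁻¹ with hm
    have hm₀ : 0 ≤ m := Finset.prod_nonneg fun i _ => by positivity
    have hnk : (0 : ℝ) < n k := by exact_mod_cast NeZero.pos (n k)
    have hδk := hδ (k + 1)
    set z := 2 * r / (n k * δ (k + 1)) with hz
    have hz₀ : 0 ≤ z := by positivity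
    have hfine : (r / δ (k + 1) + 1) * ∏ i ∈ Finset.range (k + 1), (n i : ℝ)⁻¹ ≤ m * z := by
      rw [Finset.prod_range_succ, ← hm]
      calc (r / δ (k + 1) + 1) * (m * (n k : ℝ)⁻¹)
          ≤ (r / δ (k + 1) + r / δ (k + 1)) * (m * (n k : ℝ)⁻¹) := by
            gcongr
            exact (one_le_div hδk).2 hspec
        _ = m * z := by rw [hz]; field_simp; ring
    have hmin : branchMeasure n (φ ⁻¹' U) ≤ ENNReal.ofReal (min m (m * z)) := by
      rw [ENNReal.ofReal_min]
      exact le_min (branchMeasure_preimage_le_of_lt (hsep k) hlt hU)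
        ((branchMeasure_preimage_le hδk (hsep (k + 1)) hr.le hU).trans
          (ENNReal.ofReal_le_ofReal hfine))
    refine hmin.trans (ENNReal.ofReal_le_ofReal ?_)
    calc min m (m * z) ≤ m * z ^ (s : ℝ) := min_le_mul_rpow hm₀ hz₀ hs₀'.le hs₁
      _ ≤ A * (n k * δ (k + 1)) ^ (s : ℝ) * z ^ (s : ℝ) := by
        gcongr
        exact hk₀ k hk
      _ = A * 2 ^ (s : ℝ) * r ^ (s : ℝ) := by
        rw [mul_assoc, mul_assoc, ← Real.mul_rpow (by positivity) hz₀,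
          ← Real.mul_rpow zero_le_two hr.le, hz, mul_div_cancel₀ _ (by positivity)]
  · simp [OuterMeasure.map_apply]

theorem le_dimH_of_tree {α : Type*} {V : ℕ → Set α} {I : α → Set ℝ} {R : α → α → Prop} {u₀ : α}
    (hroot : u₀ ∈ V 0) (hcompact : ∀ u, IsCompact (I u)) (hne : ∀ u, (I u).Nonempty)
    (hnested : ∀ u v, R u v → I v ⊆ I u)
    (hchild : ∀ k, ∀ u ∈ V k, ∃ c : Fin (n k) → α, Function.Injective c ∧
      ∀ j, c j ∈ V (k + 1) ∧ R u (c j))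
    {δ : ℕ → ℝ} (hδ : ∀ k, 0 < δ k) (hanti : Antitone δ) (hδ₀ : Tendsto δ atTop (𝓝 0))
    (hsep : ∀ k, ∀ u ∈ V k, ∀ v ∈ V k, u ≠ v → ∀ x ∈ I u, ∀ y ∈ I v, δ k ≤ |x - y|)
    {s : ℝ≥0} (hs₀ : 0 < s) (hs₁ : s ≤ 1) {A : ℝ}
    (hmass : ∀ᶠ k in atTop, ∏ i ∈ Finset.range k, (n i : ℝ)⁻¹ ≤ A * (n k * δ (k + 1)) ^ (s : ℝ))
    {E : Set ℝ}
    (hE : ∀ w : ℕ → α, w 0 = u₀ → (∀ k, R (w k) (w (k + 1))) → ∀ x, (∀ k, x ∈ I (w k)) → x ∈ E) :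
    s ≤ dimH E := by
  have : Nonempty α := ⟨u₀⟩
  choose! child hinj hV hR using hchild
  have hmem (a : ∀ k, Fin (n k)) (k : ℕ) : treeNode u₀ child a k ∈ V k := by
    induction k with
    | zero => exact hroot
    | succ k ih => exact hV k _ ih (a k)
  have hrel (a : ∀ k, Fin (n k)) (k : ℕ) :
      R (treeNode u₀ child a k) (treeNode u₀ child a (k + 1)) := hR k _ (hmem a k) (a k)
  have hlimit (a : ∀ k, Fin (n k)) : ∃ x, ∀ k, x ∈ I (treeNode u₀ child a k) := by
    simpa only [Set.Nonempty, mem_iInter] using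
      IsCompact.nonempty_iInter_of_sequence_nonempty_isCompact_isClosed
        (fun k => I (treeNode u₀ child a k)) (fun k => hnested _ _ (hrel a k)) (fun k => hne _)
        (hcompact _) fun k => (hcompact _).isClosed
  choose φ hφ using hlimit
  have hrange : range φ ⊆ E := by
    rintro _ ⟨a, rfl⟩
    exact hE (treeNode u₀ child a) rfl (hrel a) _ (hφ a)
  refine (le_dimH_range_of_separated hδ hanti hδ₀ (fun k a b hab => ?_) hs₀ hs₁ hmass).trans
    (dimH_mono hrange)
  classical
  have hab' : ∃ i, a i ≠ b i := hab.imp fun i hi => hi.2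
  obtain ⟨i, hik, hi⟩ := hab
  set j := Nat.find hab'
  have hprefix : treeNode u₀ child a j = treeNode u₀ child b j :=
    treeNode_congr fun i hi => not_not.1 (Nat.find_min hab' hi)
  have hnode : treeNode u₀ child a (j + 1) ≠ treeNode u₀ child b (j + 1) := by
    rw [treeNode, treeNode, hprefix]
    exact (hinj j _ (hmem b j)).ne (Nat.find_spec hab')
  exact (hanti (Nat.succ_le_of_lt ((Nat.find_min' hab' hi).trans_lt hik))).trans
    (hsep (j + 1) _ (hmem a _) _ (hmem b _) hnode _ (hφ a _) _ (hφ b _))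

end Trees

section Rationals

open MeasureTheory

lemma cast_den_pos (v : ℚ) : (0 : ℝ) < v.den :=
  Nat.cast_pos.2 v.den_pos

lemma one_div_den_mul_den_le_abs_sub {u v : ℚ} (huv : u ≠ v) :
    1 / ((u.den : ℝ) * v.den) ≤ |(u : ℝ) - v| := by
  have hu := cast_den_pos u
  have hv := cast_den_pos v
  have hsub : (u : ℝ) - v = ((u.num * v.den - v.num * u.den : ℤ) : ℝ) / (u.den * v.den) := by
    rw [u.cast_def, v.cast_def]
    push_cast
    field_simp
  have hne : u.num * v.den - v.num * u.den ≠ 0 := fun h =>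
    huv (Rat.eq_iff_mul_eq_mul.2 (sub_eq_zero.1 h))
  rw [hsub, abs_div, abs_of_pos (mul_pos hu hv)]
  gcongr
  exact_mod_cast Int.one_le_abs hne

lemma one_div_sq_le_abs_sub {u v : ℚ} (huv : u ≠ v) {D : ℝ} (hu : (u.den : ℝ) ≤ D)
    (hv : (v.den : ℝ) ≤ D) : 1 / D ^ 2 ≤ |(u : ℝ) - v| := by
  refine le_trans ?_ (one_div_den_mul_den_le_abs_sub huv)
  have hu₀ := cast_den_pos u
  rw [sq]
  gcongr
  exact hu₀.le.trans hu

lemma one_div_den_le_abs_sub {u v : ℚ} (huv : u ≠ v) (hden : u.den = v.den) :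
    1 / (v.den : ℝ) ≤ |(u : ℝ) - v| := by
  have hv := cast_den_pos v
  have hne : u.num - v.num ≠ 0 := sub_ne_zero.2 fun h => huv (Rat.ext h hden)
  rw [u.cast_def, v.cast_def, hden, ← sub_div, abs_div, abs_of_pos hv]
  gcongr
  exact_mod_cast Int.one_le_abs hne

lemma finite_setOf_den_le_mem_Icc (D : ℕ) (a b : ℝ) :
    {v : ℚ | v.den ≤ D ∧ (v : ℝ) ∈ Icc a b}.Finite := by
  have hfin : (⋃ d ∈ Iic D, (fun p : ℤ => (p / d : ℚ)) '' Icc ⌈d * a⌉ ⌊d * b⌋).Finite :=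
    (finite_Iic D).biUnion fun d _ => (finite_Icc _ _).image _
  refine hfin.subset fun v hv => ?_
  obtain ⟨hvD, hva, hvb⟩ : v.den ≤ D ∧ (v : ℝ) ∈ Icc a b := hv
  have hnum : (v.num : ℝ) = v.den * v := by exact_mod_cast v.den_mul_eq_num.symm
  simp only [mem_iUnion, mem_image]
  refine ⟨v.den, hvD, v.num, ⟨Int.ceil_le.2 ?_, Int.le_floor.2 ?_⟩, v.num_div_den⟩
  all_goals rw [hnum]; gcongr

lemma abs_sub_le_of_mem_Icc {x y a l : ℝ} (hx : x ∈ Icc a (a + l)) (hy : y ∈ Icc a (a + l)) :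
    |x - y| ≤ l := by
  simpa using abs_sub_le_of_le_of_le hx.1 hx.2 hy.1 hy.2

lemma card_le_of_den_le {F : Finset ℚ} {a l D : ℝ} (hD : 0 < D) (hl : 0 ≤ l)
    (hF : ∀ v ∈ F, (v : ℝ) ∈ Icc a (a + l)) (hden : ∀ v ∈ F, (v.den : ℝ) ≤ D) :
    (F.card : ℝ) ≤ D ^ 2 * l + 1 := by
  have hcard := card_le_of_separated (f := fun v : ℚ => (v : ℝ)) (δ := 1 / D ^ 2) (by positivity) hl
    (fun u hu v hv => abs_sub_le_of_mem_Icc (hF u hu) (hF v hv))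
    fun u hu v hv huv => one_div_sq_le_abs_sub huv (hden u hu) (hden v hv)
  rwa [div_div_eq_mul_div, div_one, mul_comm] at hcard

lemma card_le_of_den_eq {F : Finset ℚ} {a l : ℝ} {d : ℕ} (hd : 0 < d) (hl : 0 ≤ l)
    (hF : ∀ v ∈ F, (v : ℝ) ∈ Icc a (a + l)) (hden : ∀ v ∈ F, v.den = d) :
    (F.card : ℝ) ≤ d * l + 1 := by
  have hcard := card_le_of_separated (f := fun v : ℚ => (v : ℝ)) (δ := 1 / (d : ℝ)) (by positivity)
    hl (fun u hu v hv => abs_sub_le_of_mem_Icc (hF u hu) (hF v hv)) fun u hu v hv huv => by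
      rw [← hden v hv]
      exact one_div_den_le_abs_sub huv ((hden u hu).trans (hden v hv).symm)
  rwa [div_div_eq_mul_div, div_one, mul_comm] at hcard

lemma volume_biUnion_closedBall_le {ι : Type*} {T : Set ι} (hT : T.Finite) {c ρ : ι → ℝ} {N r : ℝ}
    (hN : (hT.toFinset.card : ℝ) ≤ N) (hr : 0 ≤ r) (hρ : ∀ i ∈ T, ρ i ≤ r) :
    volume (⋃ i ∈ T, Metric.closedBall (c i) (ρ i)) ≤ ENNReal.ofReal (N * (2 * r)) := by
  calc volume (⋃ i ∈ T, Metric.closedBall (c i) (ρ i))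
      = volume (⋃ i ∈ hT.toFinset, Metric.closedBall (c i) (ρ i)) := by
        simp only [Finite.mem_toFinset]
    _ ≤ ∑ i ∈ hT.toFinset, volume (Metric.closedBall (c i) (ρ i)) :=
        measure_biUnion_finset_le _ _
    _ ≤ ∑ _i ∈ hT.toFinset, ENNReal.ofReal (2 * r) := by
        refine Finset.sum_le_sum fun i hi => ?_
        rw [Real.volume_closedBall]
        gcongr
        exact hρ i (hT.mem_toFinset.1 hi)
    _ = ENNReal.ofReal (hT.toFinset.card * (2 * r)) := by
        rw [Finset.sum_const, nsmul_eq_mul,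
          ENNReal.ofReal_mul (Nat.cast_nonneg hT.toFinset.card), ENNReal.ofReal_natCast]
    _ ≤ ENNReal.ofReal (N * (2 * r)) := by gcongr

section Neighbourhoods

variable {S : Set ℚ} {v₀ : ℚ} {g : ℝ → ℝ} {ρ : ℚ → ℝ} {a l r : ℝ} {j J : ℕ}

lemma volume_iUnion_closedBall_dyadic_le (hg : AntitoneOn g (Ioi 0)) (hg₀ : ∀ q, 0 < q → 0 ≤ g q)
    (hl : 0 ≤ l) (hS : ∀ v ∈ S, (v : ℝ) ∈ Icc a (a + l)) (hv₀ : v₀ ∈ S)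
    (hmin : ∀ v ∈ S, v₀.den ≤ v.den) (hρ : ∀ v ∈ S, ρ v ≤ g v.den) :
    volume (⋃ v ∈ {v ∈ S | v ≠ v₀ ∧ Nat.log 2 v.den = j}, Metric.closedBall (v : ℝ) (ρ v)) ≤
      ENNReal.ofReal (8 * l * (4 ^ j * g (2 ^ j))) := by
  classical
  set T := {v ∈ S | v ≠ v₀ ∧ Nat.log 2 v.den = j}
  have hlow : ∀ v ∈ T, (2 : ℝ) ^ j ≤ v.den := by
    rintro v ⟨-, -, rfl⟩
    exact_mod_cast Nat.pow_log_le_self 2 v.den_nz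
  have hup : ∀ v ∈ T, v.den ≤ 2 ^ (j + 1) := by
    rintro v ⟨-, -, rfl⟩
    exact (Nat.lt_pow_succ_log_self one_lt_two _).le
  have hT : T.Finite := (finite_setOf_den_le_mem_Icc (2 ^ (j + 1)) a (a + l)).subset
    fun v (hv : v ∈ T) => ⟨hup v hv, hS v hv.1⟩
  rcases T.eq_empty_or_nonempty with hempty | ⟨v₁, hv₁⟩
  · simp [hempty]
  have hcard : (hT.toFinset.card : ℝ) ≤ (2 ^ (j + 1)) ^ 2 * l := by
    have hnotMem : v₀ ∉ hT.toFinset := fun h => (hT.mem_toFinset.1 h).2.1 rfl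
    have hcard' := card_le_of_den_le (F := insert v₀ hT.toFinset) (D := 2 ^ (j + 1)) (by positivity)
      hl (by simpa only [Finset.forall_mem_insert, Finite.mem_toFinset] using
        ⟨hS v₀ hv₀, fun v (hv : v ∈ T) => hS v hv.1⟩)
      (by simpa only [Finset.forall_mem_insert, Finite.mem_toFinset] using
        ⟨mod_cast (hmin v₁ hv₁.1).trans (hup v₁ hv₁), fun v hv => mod_cast hup v hv⟩)
    rw [Finset.card_insert_of_notMem hnotMem, Nat.cast_add_one] at hcard'
    linarith
  refine (volume_biUnion_closedBall_le hT hcard (hg₀ _ (by positivity)) fun v hv =>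
    (hρ v hv.1).trans (hg (by simp) (by simp [v.den_pos]) (hlow v hv))).trans_eq ?_
  rw [pow_right_comm, pow_succ (2 ^ 2 : ℝ)]
  ring_nf

theorem volume_iUnion_closedBall_rat_le (hg : AntitoneOn g (Ioi 0)) (hg₀ : ∀ q, 0 < q → 0 ≤ g q)
    (hsum : Summable fun k : ℕ => 4 ^ k * g (2 ^ k)) (hl : 0 ≤ l) (hr : 0 ≤ r)
    (hS : ∀ v ∈ S, (v : ℝ) ∈ Icc a (a + l)) (hJ : ∀ v ∈ S, 2 ^ J ≤ v.den)
    (hρr : ∀ v ∈ S, ρ v ≤ r) (hρ : ∀ v ∈ S, ρ v ≤ g v.den) :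
    volume (⋃ v ∈ S, Metric.closedBall (v : ℝ) (ρ v)) ≤
      ENNReal.ofReal (2 * r + 8 * l * ∑' k, 4 ^ (k + J) * g (2 ^ (k + J))) := by
  rcases S.eq_empty_or_nonempty with rfl | hne
  · simp
  set v₀ := Function.argminOn Rat.den S hne
  have hv₀ : v₀ ∈ S := Function.argminOn_mem _ _ _
  have hmin : ∀ v ∈ S, v₀.den ≤ v.den := fun v hv => Function.argminOn_le _ _ hv
  have hterm : ∀ k, 0 ≤ (4 : ℝ) ^ (k + J) * g (2 ^ (k + J)) := fun k =>
    mul_nonneg (by positivity) (hg₀ _ (by positivity))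
  have hcover : (⋃ v ∈ S, Metric.closedBall (v : ℝ) (ρ v)) ⊆ Metric.closedBall (v₀ : ℝ) (ρ v₀) ∪
      ⋃ k, ⋃ v ∈ {v ∈ S | v ≠ v₀ ∧ Nat.log 2 v.den = k + J},
        Metric.closedBall (v : ℝ) (ρ v) := by
    refine iUnion₂_subset fun v hv x hx => ?_
    rcases eq_or_ne v v₀ with rfl | hvv₀
    · exact Or.inl hx
    · obtain ⟨k, hk⟩ := Nat.exists_eq_add_of_le'
        (Nat.le_log_of_pow_le one_lt_two (hJ v hv))
      exact Or.inr (mem_iUnion.2 ⟨k, mem_biUnion ⟨hv, hvv₀, hk⟩ hx⟩)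
  refine (measure_mono hcover).trans ((measure_union_le _ _).trans ?_)
  rw [ENNReal.ofReal_add (by positivity) (mul_nonneg (by positivity) (tsum_nonneg hterm)),
    Real.volume_closedBall]
  gcongr
  · exact hρr v₀ hv₀
  · rw [← tsum_mul_left, ENNReal.ofReal_tsum_of_nonneg
      (fun k => mul_nonneg (by positivity) (hterm k))
      (((summable_nat_add_iff J).2 hsum).mul_left _)]
    exact (measure_iUnion_le _).trans (ENNReal.tsum_le_tsum fun k =>
      volume_iUnion_closedBall_dyadic_le hg hg₀ hl hS hv₀ hmin hρ)

end Neighbourhoods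

section Dirichlet

variable {a l K : ℝ}

lemma volume_setOf_near_den_eq_le {d : ℕ} (hd : 0 < d) (hl : 0 ≤ l) {ε : ℝ} (hε : 0 ≤ ε) :
    volume {x ∈ Icc a (a + l) | ∃ w : ℚ, w.den = d ∧ |x - w| ≤ ε} ≤
      ENNReal.ofReal ((d * (l + 2 * ε) + 1) * (2 * ε)) := by
  set T := {w : ℚ | w.den = d ∧ (w : ℝ) ∈ Icc (a - ε) (a - ε + (l + 2 * ε))}
  have hT : T.Finite := (finite_setOf_den_le_mem_Icc d _ _).subset
    fun w (hw : w ∈ T) => ⟨hw.1.le, hw.2⟩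
  have hcard : (hT.toFinset.card : ℝ) ≤ d * (l + 2 * ε) + 1 :=
    card_le_of_den_eq hd (by positivity) (fun w hw => (hT.mem_toFinset.1 hw).2)
      fun w hw => (hT.mem_toFinset.1 hw).1
  refine (measure_mono ?_).trans (volume_biUnion_closedBall_le (c := fun w : ℚ => (w : ℝ))
    (ρ := fun _ => ε) hT hcard hε fun _ _ => le_rfl)
  rintro x ⟨⟨hxa, hxl⟩, w, hw, hxw⟩
  obtain ⟨h₁, h₂⟩ := abs_le.1 hxw
  exact mem_biUnion ⟨hw, by linarith, by linarith⟩ hxw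

lemma exists_rat_den_lt_of_not_approximable {X : ℕ} (hX : 0 < X) (hK : 0 < K) {x : ℝ}
    (hx : ¬ ∃ w : ℚ, X / K ≤ w.den ∧ w.den ≤ X ∧ |x - w| ≤ K / X ^ 2) :
    ∃ w : ℚ, (w.den : ℝ) < X / K ∧ |x - w| ≤ 1 / (X * w.den) := by
  obtain ⟨w, hxw, hwX⟩ := Real.exists_rat_abs_sub_le_and_den_le x hX
  have hxw' : |x - w| ≤ 1 / (X * w.den) := hxw.trans (by gcongr; linarith)
  refine ⟨w, ?_, hxw'⟩
  by_contra! hden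
  refine hx ⟨w, hden, hwX, hxw'.trans ?_⟩
  calc 1 / (X * (w.den : ℝ)) ≤ 1 / (X * (X / K)) := by gcongr
    _ = K / X ^ 2 := by field_simp

lemma eventually_sum_range_one_div_le {ε : ℝ} (hε : 0 < ε) :
    ∀ᶠ X : ℕ in atTop, ∑ i ∈ Finset.range X, 1 / ((i : ℝ) + 1) ≤ ε * X := by
  have hces : Tendsto (fun n : ℕ => (n : ℝ)⁻¹ * ∑ i ∈ Finset.range n, 1 / ((i : ℝ) + 1))
      atTop (𝓝 0) := tendsto_one_div_add_atTop_nhds_zero_nat.cesaro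
  filter_upwards [hces.eventually (eventually_le_nhds hε), eventually_gt_atTop 0] with X hX hX₀
  rwa [inv_mul_le_iff₀ (by exact_mod_cast hX₀), mul_comm] at hX

/- Dirichlet's theorem approximates every point with a denominator at most `X`; the points for
which only denominators below `X / K` are available lie in few short intervals. -/
theorem eventually_volume_not_approximable_le (a : ℝ) (hl : 0 < l) (hK : 1 ≤ K) :
    ∀ᶠ X : ℕ in atTop, volume {x ∈ Icc a (a + l) |
      ¬ ∃ w : ℚ, X / K ≤ w.den ∧ w.den ≤ X ∧ |x - w| ≤ K / X ^ 2} ≤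
        ENNReal.ofReal (3 * l / K) := by
  have hK₀ : 0 < K := one_pos.trans_le hK
  filter_upwards [eventually_sum_range_one_div_le (show 0 < l / (6 * K) by positivity),
    eventually_gt_atTop 0] with X hharm hX
  have hX₀ : (0 : ℝ) < X := by exact_mod_cast hX
  set M := ⌊X / K⌋₊
  have hM : (M : ℝ) ≤ X / K := Nat.floor_le (by positivity)
  have hMX : M ≤ X := by exact_mod_cast hM.trans (div_le_self hX₀.le hK)
  have hcover : {x ∈ Icc a (a + l) |
      ¬ ∃ w : ℚ, X / K ≤ w.den ∧ w.den ≤ X ∧ |x - w| ≤ K / X ^ 2} ⊆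
      ⋃ i ∈ Finset.range M,
        {x ∈ Icc a (a + l) | ∃ w : ℚ, w.den = i + 1 ∧ |x - w| ≤ 1 / (X * (i + 1))} := by
    rintro x ⟨hxl, hx⟩
    obtain ⟨w, hw, hxw⟩ := exists_rat_den_lt_of_not_approximable hX hK₀ hx
    obtain ⟨i, hi⟩ := Nat.exists_eq_succ_of_ne_zero w.den_nz
    have hiM : i < M := Nat.lt_of_succ_le (hi ▸ Nat.le_floor hw.le)
    refine mem_biUnion (Finset.mem_coe.2 (Finset.mem_range.2 hiM)) ⟨hxl, w, hi, ?_⟩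
    rwa [hi, Nat.cast_succ] at hxw
  have hlevel : ∀ i : ℕ,
      volume {x ∈ Icc a (a + l) | ∃ w : ℚ, w.den = i + 1 ∧ |x - w| ≤ 1 / (X * (i + 1))} ≤
        ENNReal.ofReal (2 * l / X + 6 / X * (1 / ((i : ℝ) + 1))) := fun i => by
    refine (volume_setOf_near_den_eq_le i.succ_pos hl.le (by positivity)).trans
      (ENNReal.ofReal_le_ofReal ?_)
    have hX₁ : (1 : ℝ) ≤ X := by exact_mod_cast hX
    calc _ = (2 * l + (4 / X + 2) / (i + 1)) / X := by push_cast; field_simp; ring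
      _ ≤ (2 * l + (4 / 1 + 2) / (i + 1)) / X := by gcongr
      _ = _ := by field_simp; ring
  calc _ ≤ ∑ i ∈ Finset.range M, ENNReal.ofReal (2 * l / X + 6 / X * (1 / ((i : ℝ) + 1))) :=
        (measure_mono hcover).trans ((measure_biUnion_finset_le _ _).trans
          (Finset.sum_le_sum fun i _ => hlevel i))
    _ = ENNReal.ofReal (M * (2 * l / X) + 6 / X * ∑ i ∈ Finset.range M, 1 / ((i : ℝ) + 1)) := by
        rw [← ENNReal.ofReal_sum_of_nonneg fun i _ => by positivity, Finset.sum_add_distrib,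
          Finset.sum_const, Finset.card_range, nsmul_eq_mul, ← Finset.mul_sum]
    _ ≤ ENNReal.ofReal (X / K * (2 * l / X) + 6 / X * (l / (6 * K) * X)) := by
        gcongr
        refine le_trans ?_ hharm
        exact Finset.sum_le_sum_of_subset_of_nonneg (Finset.range_mono hMX) fun i _ _ => by
          positivity
    _ = ENNReal.ofReal (3 * l / K) := by congr 1; field_simp; ring

theorem eventually_exists_finset_rat_near (a : ℝ) (hl : 0 < l) (hK : 1 ≤ K) (B : Set ℝ) :
    ∀ᶠ X : ℕ in atTop, ∃ F : Finset ℚ,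
      (∀ w ∈ F, X / K ≤ w.den ∧ w.den ≤ X ∧ ∃ x ∈ Icc a (a + l), x ∉ B ∧ |x - w| ≤ K / X ^ 2) ∧
      ENNReal.ofReal l ≤ ENNReal.ofReal (F.card * (2 * (K / X ^ 2))) + volume B +
        ENNReal.ofReal (3 * l / K) := by
  filter_upwards [eventually_volume_not_approximable_le a hl hK] with X hX
  set T := {w : ℚ | X / K ≤ w.den ∧ w.den ≤ X ∧ ∃ x ∈ Icc a (a + l), x ∉ B ∧ |x - w| ≤ K / X ^ 2}
  have hT : T.Finite := (finite_setOf_den_le_mem_Icc X (a - K / X ^ 2) (a + l + K / X ^ 2)).subset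
    fun w (hw : w ∈ T) => by
      obtain ⟨-, hwX, x, ⟨hxa, hxl⟩, -, hxw⟩ := hw
      obtain ⟨h₁, h₂⟩ := abs_le.1 hxw
      exact ⟨hwX, by linarith, by linarith⟩
  refine ⟨hT.toFinset, fun w hw => hT.mem_toFinset.1 hw, ?_⟩
  have hcover : Icc a (a + l) ⊆ (⋃ w ∈ T, Metric.closedBall (w : ℝ) (K / X ^ 2)) ∪ B ∪
      {x ∈ Icc a (a + l) |
        ¬ ∃ w : ℚ, X / K ≤ w.den ∧ w.den ≤ X ∧ |x - w| ≤ K / X ^ 2} := fun x hx => by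
    by_cases hxB : x ∈ B
    · exact Or.inl (Or.inr hxB)
    by_cases hex : ∃ w : ℚ, X / K ≤ w.den ∧ w.den ≤ X ∧ |x - w| ≤ K / X ^ 2
    · obtain ⟨w, hw, hwX, hxw⟩ := hex
      exact Or.inl (Or.inl (mem_biUnion ⟨hw, hwX, x, hx, hxB, hxw⟩ hxw))
    · exact Or.inr ⟨hx, hex⟩
  calc ENNReal.ofReal l = volume (Icc a (a + l)) := by simp
    _ ≤ _ := (measure_mono hcover).trans (measure_union_le _ _)
    _ ≤ _ := add_le_add ((measure_union_le _ _).trans (add_le_add_left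
        (volume_biUnion_closedBall_le hT le_rfl (by positivity) fun _ _ => le_rfl) _)) hX

end Dirichlet

section BadlyApproximable

open Polynomial in
lemma exists_pos_div_den_sq_le_abs_sqrt_two_sub :
    ∃ c > 0, ∀ v : ℚ, c / (v.den : ℝ) ^ 2 ≤ |√2 - v| := by
  obtain ⟨A, hA, hle⟩ := Liouville.exists_pos_real_of_irrational_root irrational_sqrt_two
    (f := X ^ 2 - C 2) (X_pow_sub_C_ne_zero two_pos 2) (by simp)
  refine ⟨A⁻¹, by positivity, fun v => ?_⟩
  obtain ⟨b, hb⟩ := Nat.exists_eq_succ_of_ne_zero v.den_nz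
  have hv : (v : ℝ) = v.num / (b + 1) := by rw [v.cast_def, hb, Nat.cast_succ]
  have hvb := hle v.num b
  rw [natDegree_X_pow_sub_C, ← hv] at hvb
  rw [hb, Nat.cast_succ, div_le_iff₀ (by positivity), inv_le_iff_one_le_mul₀ hA]
  linarith

/- The convergents of a badly approximable number are badly approximable by rationals of smaller
denominator, with a uniform constant. -/
lemma exists_rat_forall_den_lt_div_den_sq_le {x c : ℝ} (hx : Irrational x) (hc : 0 < c)
    (hxc : ∀ v : ℚ, c / (v.den : ℝ) ^ 2 ≤ |x - v|) (Q : ℕ) :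
    ∃ w : ℚ, Q ≤ w.den ∧
      ∀ v : ℚ, v.den < w.den → min (c / 2) (√(c / 2)) / (v.den : ℝ) ^ 2 ≤ |(w : ℝ) - v| := by
  obtain ⟨w, hw, hwQ⟩ : ∃ w : ℚ, |x - w| < 1 / (w.den : ℝ) ^ 2 ∧ Q ≤ w.den := by
    by_contra! hcon
    refine Real.infinite_rat_abs_sub_lt_one_div_den_sq_of_irrational hx
      ((finite_setOf_den_le_mem_Icc Q (x - 1) (x + 1)).subset fun v hv => ?_)
    have hv' : |x - v| < 1 / (v.den : ℝ) ^ 2 := hv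
    have hv₁ : |x - v| ≤ 1 := hv'.le.trans (div_le_one_of_le₀
      (one_le_pow₀ (by exact_mod_cast v.den_pos)) (by positivity))
    obtain ⟨h₁, h₂⟩ := abs_le.1 hv₁
    exact ⟨(hcon v hv').le, by linarith, by linarith⟩
  refine ⟨w, hwQ, fun v hvw => ?_⟩
  rcases le_or_gt (v.den : ℝ) (√(c / 2) * w.den) with hsmall | hlarge
  · have hvw' : 1 / (w.den : ℝ) ^ 2 ≤ c / 2 / (v.den : ℝ) ^ 2 := by
      have hsq : (v.den : ℝ) ^ 2 ≤ c / 2 * w.den ^ 2 := by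
        calc (v.den : ℝ) ^ 2 ≤ (√(c / 2) * w.den) ^ 2 := by gcongr
          _ = c / 2 * w.den ^ 2 := by rw [mul_pow, Real.sq_sqrt (by positivity)]
      rwa [div_le_div_iff₀ (by positivity) (by positivity), one_mul]
    calc min (c / 2) (√(c / 2)) / (v.den : ℝ) ^ 2 ≤ c / 2 / (v.den : ℝ) ^ 2 := by
          gcongr
          exact min_le_left _ _
      _ = c / (v.den : ℝ) ^ 2 - c / 2 / (v.den : ℝ) ^ 2 := by ring
      _ ≤ |x - v| - |x - w| := by linarith [hxc v]
      _ ≤ |(w : ℝ) - v| := by linarith [abs_sub_le x w v]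
  · calc min (c / 2) (√(c / 2)) / (v.den : ℝ) ^ 2 ≤ √(c / 2) / (v.den : ℝ) ^ 2 := by
          gcongr
          exact min_le_right _ _
      _ ≤ 1 / ((w.den : ℝ) * v.den) := by
          rw [div_le_div_iff₀ (by positivity) (by positivity)]
          nlinarith
      _ ≤ |(w : ℝ) - v| := one_div_den_mul_den_le_abs_sub fun h => hvw.ne (by rw [h])

end BadlyApproximable

end Rationals

/-- The hypotheses under which the lower bound is proved directly. In contrast with the main
theorem, `ω ≤ 1 / 2` everywhere, and the condition at infinity is the one at the denominator
`1 / Ψ q` of the right endpoints `p / q + Ψ q`. -/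
structure Admissible (Ψ ω : ℝ → ℝ) : Prop where
  decay : QuadraticDecay Ψ
  decay_mul : QuadraticDecay fun q => Ψ q * ω q
  le_half : ∀ q, 0 < q → ω q ≤ 1 / 2
  div : SquareDivisibility Ψ
  summable : Summable fun q : ℕ => (q : ℝ) * Ψ q
  le_mul : ∀ᶠ q : ℕ in atTop, 20 * Ψ (Ψ q)⁻¹ ≤ Ψ q * ω q

/-- From the denominator `2 ^ J` on, the asymptotic hypotheses on `Ψ` and `ω` hold with the
constants needed by the construction; the dyadic tail bounds the measure of neighbourhoods of
rationals of denominator at least `2 ^ J`. -/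
structure IsThreshold (Ψ ω : ℝ → ℝ) (J : ℕ) : Prop where
  tail_le : ∑' k : ℕ, 4 ^ (k + J) * Ψ (2 ^ (k + J)) ≤ 1 / 100000
  le_mul : ∀ q : ℕ, 2 ^ J ≤ q → 20 * Ψ (Ψ q)⁻¹ ≤ Ψ q * ω q

/-- The rational `w` of denominator `d` is far, in comparison with `d ^ 2 * Ψ d`, from all rationals
of smaller denominator. -/
def IsRemote (Ψ : ℝ → ℝ) (w : ℚ) : Prop :=
  ∀ v : ℚ, v.den < w.den → 44 * ((w.den : ℝ) ^ 2 * Ψ w.den) / (v.den : ℝ) ^ 2 ≤ |(w : ℝ) - v|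

/-- The points to the right of `w` whose distance to `w` lies between `(1 - ω d) * Ψ d` and `Ψ d`,
where `d` is the denominator of `w`. -/
def contactInterval (Ψ ω : ℝ → ℝ) (w : ℚ) : Set ℝ :=
  Icc ((w : ℝ) + Ψ w.den - Ψ w.den * ω w.den) (w + Ψ w.den)

section Endpoint

variable {Ψ : ℝ → ℝ} {w v : ℚ} {P : ℝ} {m : ℤ}

lemma exists_int_sub_eq_add_sub_eq (hP : 0 < P) (hm : P⁻¹ = (w.den : ℝ) ^ 2 * m) (v : ℚ) :
    ∃ a b : ℤ, (v : ℝ) - w = (w.den * a - w.num * b : ℤ) / (w.den * v.den) ∧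
      w + P - v = b * P / v.den := by
  set t : ℤ := v.num * w.den - w.num * v.den with ht
  have hvw : (v : ℝ) - w = t / (w.den * v.den) := by
    rw [Rat.cast_def v, Rat.cast_def w, ht]
    push_cast
    field_simp
  refine ⟨v.num - w.num * t * m, v.den - t * w.den * m, ?_, ?_⟩
  · rw [hvw, ht]
    push_cast
    ring
  · have hmP : (w.den : ℝ) ^ 2 * m * P = 1 := by rw [← hm, inv_mul_cancel₀ hP.ne']
    have hsub : (w : ℝ) + P - v = P - t / (w.den * v.den) := by linarith
    rw [hsub]
    push_cast
    field_simp
    linear_combination (t : ℝ) * hmP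

lemma inv_le_den_of_eq_add (hP : 0 < P) (hm : P⁻¹ = (w.den : ℝ) ^ 2 * m) (hv : (v : ℝ) = w + P) :
    P⁻¹ ≤ v.den := by
  have hi := cast_den_pos v
  obtain ⟨a, b, hvw, hb⟩ := exists_int_sub_eq_add_sub_eq hP hm v
  have hb₀ : b = 0 := by
    rw [← hv, sub_self, eq_comm, div_eq_zero_iff, mul_eq_zero, Int.cast_eq_zero] at hb
    exact (hb.resolve_right hi.ne').resolve_right hP.ne'
  have hPa : P = a / v.den := by
    rw [hb₀, hv, add_sub_cancel_left, mul_zero, sub_zero] at hvw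
    rw [hvw]
    push_cast
    field_simp
  have ha : 0 < a := by
    have : (0 : ℝ) < a := by rw [eq_div_iff hi.ne'] at hPa; rw [← hPa]; positivity
    exact_mod_cast this
  rw [inv_le_comm₀ hP hi, hPa, inv_eq_one_div]
  gcongr
  exact_mod_cast ha

namespace IsRemote

lemma le_abs_sub (hw : IsRemote Ψ w) (hΨ : 44 * ((w.den : ℝ) ^ 2 * Ψ w.den) ≤ 1) (hvw : v ≠ w) :
    44 * ((w.den : ℝ) ^ 2 * Ψ w.den) / (v.den : ℝ) ^ 2 ≤ |(w : ℝ) - v| := by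
  rcases lt_or_ge v.den w.den with hlt | hge
  · exact hw v hlt
  · calc 44 * ((w.den : ℝ) ^ 2 * Ψ w.den) / (v.den : ℝ) ^ 2 ≤ 1 / (v.den : ℝ) ^ 2 := by gcongr
      _ ≤ |(w : ℝ) - v| := one_div_sq_le_abs_sub hvw.symm (by exact_mod_cast hge) le_rfl

lemma le_abs_int_mul_abs_int (hw : IsRemote Ψ w) (hΨ₀ : 0 ≤ Ψ w.den)
    (hΨ : 44 * ((w.den : ℝ) ^ 2 * Ψ w.den) ≤ 1) {a b : ℤ} (hb : b ≠ 0)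
    (hab : (w.den * a - w.num * b : ℤ) ≠ 0) :
    44 * ((w.den : ℝ) ^ 3 * Ψ w.den) ≤ |((w.den * a - w.num * b : ℤ) : ℝ)| * |(b : ℝ)| := by
  have hb' : (b : ℝ) ≠ 0 := by exact_mod_cast hb
  have hsub : (w : ℝ) - (a / b : ℚ) = -((w.den * a - w.num * b : ℤ) / (w.den * b)) := by
    rw [Rat.cast_def w]
    push_cast
    field_simp
    ring
  have hne : (a / b : ℚ) ≠ w := by
    rintro h
    rw [h, sub_self, eq_comm, neg_eq_zero, div_eq_zero_iff, Int.cast_eq_zero] at hsub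
    exact hsub.elim hab (by positivity)
  have hden : ((a / b : ℚ).den : ℝ) ≤ |(b : ℝ)| := by
    have hdvd : ((a / b : ℚ).den : ℤ) ∣ b := by
      rw [← Rat.divInt_eq_div]
      exact Rat.den_dvd a b
    exact_mod_cast Int.le_of_dvd (abs_pos.2 hb) ((dvd_abs _ _).2 hdvd)
  have hle : 44 * ((w.den : ℝ) ^ 2 * Ψ w.den) / |(b : ℝ)| ^ 2
      ≤ |((w.den * a - w.num * b : ℤ) : ℝ)| / (w.den * |(b : ℝ)|) :=
    calc _ ≤ 44 * ((w.den : ℝ) ^ 2 * Ψ w.den) / ((a / b : ℚ).den : ℝ) ^ 2 := by gcongr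
      _ ≤ |(w : ℝ) - (a / b : ℚ)| := hw.le_abs_sub hΨ hne
      _ = _ := by rw [hsub, abs_neg, abs_div, abs_mul, Nat.abs_cast]
  rw [div_le_div_iff₀ (by positivity) (by positivity)] at hle
  have hb₀ : 0 < |(b : ℝ)| := abs_pos.2 hb'
  refine le_of_mul_le_mul_right ?_ hb₀
  linarith

/- If `v` were too close to the endpoint `w + Ψ w.den`, then the integer `b` given by
`exists_int_sub_eq_add_sub_eq` would be small and `a / b` too close to the remote rational `w`. -/
lemma sq_mul_sq_le (hw : IsRemote Ψ w) (hΨ₀ : 0 < Ψ w.den)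
    (hΨ : 44 * ((w.den : ℝ) ^ 2 * Ψ w.den) ≤ 1) (hm : (Ψ w.den)⁻¹ = (w.den : ℝ) ^ 2 * m)
    (hvw : v ≠ w) (hv : (v : ℝ) ≠ w + Ψ w.den) :
    44 * ((w.den : ℝ) ^ 2 * Ψ w.den ^ 2)
      ≤ (v.den : ℝ) ^ 2 * (|(v : ℝ) - w| * |w + Ψ w.den - v|) := by
  obtain ⟨a, b, hvw_eq, hend⟩ := exists_int_sub_eq_add_sub_eq hΨ₀ hm v
  have hb : b ≠ 0 := by
    rintro rfl
    apply hv
    rw [Int.cast_zero, zero_mul, zero_div] at hend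
    linarith
  have hab : w.den * a - w.num * b ≠ 0 := by
    intro h
    apply hvw
    rw [h, Int.cast_zero, zero_div, sub_eq_zero] at hvw_eq
    exact_mod_cast hvw_eq
  have hle := hw.le_abs_int_mul_abs_int hΨ₀.le hΨ hb hab
  rw [hvw_eq, hend, abs_div, abs_div, abs_mul, abs_mul, Nat.abs_cast, Nat.abs_cast, abs_of_pos hΨ₀]
  calc 44 * ((w.den : ℝ) ^ 2 * Ψ w.den ^ 2)
      = 44 * ((w.den : ℝ) ^ 3 * Ψ w.den) * (Ψ w.den / w.den) := by field_simp
    _ ≤ |((w.den * a - w.num * b : ℤ) : ℝ)| * |(b : ℝ)| * (Ψ w.den / w.den) := by gcongr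
    _ = _ := by field_simp

end IsRemote

end Endpoint

section LowerBound

variable {Ψ ω : ℝ → ℝ}

namespace Admissible

lemma pos_right (h : Admissible Ψ ω) {q : ℝ} (hq : 0 < q) : 0 < ω q :=
  pos_of_mul_pos_right (h.decay_mul.pos q hq) (h.decay.pos q hq).le

lemma mul_le_half (h : Admissible Ψ ω) {q : ℝ} (hq : 0 < q) : Ψ q * ω q ≤ Ψ q / 2 := by
  rw [div_eq_mul_one_div]
  exact mul_le_mul_of_nonneg_left (h.le_half q hq) (h.decay.pos q hq).le

lemma eventually_isThreshold (h : Admissible Ψ ω) : ∀ᶠ J : ℕ in atTop, IsThreshold Ψ ω J := by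
  have htail := (tendsto_sum_nat_add fun k : ℕ => 4 ^ k * Ψ (2 ^ k)).eventually
    (eventually_le_nhds (show (0 : ℝ) < 1 / 100000 by norm_num))
  filter_upwards [htail, eventually_forall_ge_atTop.2 h.le_mul] with J hJ hle
  exact ⟨hJ, fun q hq => hle q (Nat.lt_two_pow_self.le.trans hq)⟩

end Admissible

namespace IsThreshold

variable {J : ℕ}

lemma sq_mul_le (hJ : IsThreshold Ψ ω J) (h : Admissible Ψ ω) {q : ℝ} (hq : 2 ^ J ≤ q) :
    q ^ 2 * Ψ q ≤ 1 / 100000 :=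
  calc q ^ 2 * Ψ q ≤ (2 ^ J) ^ 2 * Ψ (2 ^ J) := h.decay.sq_mul_le (by positivity) hq
    _ = 4 ^ (0 + J) * Ψ (2 ^ (0 + J)) := by rw [zero_add, ← pow_mul, mul_comm J, pow_mul]; norm_num
    _ ≤ ∑' k : ℕ, 4 ^ (k + J) * Ψ (2 ^ (k + J)) :=
      ((summable_nat_add_iff J).2 (h.decay.summable_condensed h.summable)).le_tsum 0 fun k _ =>
        mul_nonneg (by positivity) (h.decay.pos _ (by positivity)).le
    _ ≤ 1 / 100000 := hJ.tail_le

theorem le_of_near_contactInterval (hJ : IsThreshold Ψ ω J) (h : Admissible Ψ ω) {w v : ℚ}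
    (hwJ : 2 ^ J ≤ w.den) (hw : IsRemote Ψ w) (hvw : v ≠ w) (hden : w.den ≤ v.den) {x : ℝ}
    (hx : x ∈ contactInterval Ψ ω w) (hxv : |x - v| ≤ 2 * Ψ v.den) :
    20 * Ψ v.den ≤ Ψ w.den * ω w.den := by
  have hP : 0 < Ψ w.den := h.decay.pos _ (cast_den_pos w)
  have hΨv : 0 < Ψ v.den := h.decay.pos _ (cast_den_pos v)
  have hP_small : 44 * ((w.den : ℝ) ^ 2 * Ψ w.den) ≤ 1 := by
    linarith [hJ.sq_mul_le h (show (2 : ℝ) ^ J ≤ w.den by exact_mod_cast hwJ)]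
  have hdecay : Ψ v.den ≤ (w.den : ℝ) ^ 2 * Ψ w.den / (v.den : ℝ) ^ 2 := by
    rw [le_div_iff₀' (by positivity)]
    exact h.decay.sq_mul_le (cast_den_pos w) (by exact_mod_cast hden)
  have hgap : 44 * Ψ v.den ≤ |(w : ℝ) - v| := by
    have := hw.le_abs_sub hP_small hvw
    rw [mul_div_assoc] at this
    linarith
  obtain ⟨m, hm⟩ := h.div w.den w.den_pos
  obtain ⟨hx_left, hx_right⟩ := hx
  obtain ⟨hv_left, hv_right⟩ := abs_le.1 hxv
  have hω := h.mul_le_half (cast_den_pos w)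
  have hwv : (w : ℝ) < v := by
    by_contra! hle
    rw [abs_of_nonneg (by linarith)] at hgap
    linarith
  rw [abs_sub_comm, abs_of_pos (by linarith)] at hgap
  by_cases hend : (v : ℝ) = w + Ψ w.den
  · have hΨ_end := h.decay.le_of_le (inv_pos.2 hP) (inv_le_den_of_eq_add hP hm hend)
    linarith [hJ.le_mul w.den hwJ]
  · have hfar : 22 * Ψ v.den ≤ |w + Ψ w.den - v| := by
      have hprod := hw.sq_mul_sq_le hP hP_small hm hvw hend
      have hnear : |(v : ℝ) - w| ≤ 2 * Ψ w.den := by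
        rw [abs_of_pos (by linarith)]
        linarith
      refine le_trans (mul_le_mul_of_nonneg_left hdecay (by norm_num)) ?_
      rw [← mul_div_assoc, div_le_iff₀' (by positivity)]
      refine le_of_mul_le_mul_right ?_ (show 0 < 2 * Ψ w.den by positivity)
      calc 22 * ((w.den : ℝ) ^ 2 * Ψ w.den) * (2 * Ψ w.den)
          = 44 * ((w.den : ℝ) ^ 2 * Ψ w.den ^ 2) := by ring
        _ ≤ (v.den : ℝ) ^ 2 * (|(v : ℝ) - w| * |w + Ψ w.den - v|) := hprod
        _ ≤ (v.den : ℝ) ^ 2 * (2 * Ψ w.den * |w + Ψ w.den - v|) := by gcongr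
        _ = _ := by ring
    have hend_near : |w + Ψ w.den - v| ≤ Ψ w.den * ω w.den + 2 * Ψ v.den :=
      abs_le.2 ⟨by linarith, by linarith⟩
    linarith

end IsThreshold

/-- The radius of the neighbourhood of `v` avoided in the choice of the children of a node:
small denominators only require to stay out of the range of `Ψ`-approximation, larger ones also
have to be far from the children, in order that those be remote. -/
noncomputable def avoidRadius (Ψ : ℝ → ℝ) (T : ℕ) (v : ℚ) : ℝ :=
  if v.den < T then 2 * Ψ v.den else 45 * Ψ v.den

/-- The real number `y` lies outside the avoided neighbourhoods of all rationals, other than `w`,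
of denominator at least that of `w`. -/
def Avoids (Ψ : ℝ → ℝ) (w : ℚ) (T : ℕ) (y : ℝ) : Prop :=
  ∀ v : ℚ, v ≠ w → w.den ≤ v.den → avoidRadius Ψ T v < |y - v|

/-- The rational `u` may follow `w` in the construction of a point of `exactSet Ψ ω`: on the contact
interval of `u`, no rational of denominator between those of `w` and `u` violates the lower bound
required by exactness. -/
structure IsChild (Ψ ω : ℝ → ℝ) (w u : ℚ) : Prop where
  den_lt : w.den < u.den
  isRemote : IsRemote Ψ u
  subset : contactInterval Ψ ω u ⊆ contactInterval Ψ ω w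
  le_abs_sub : ∀ x ∈ contactInterval Ψ ω u, ∀ v : ℚ, w.den ≤ v.den → v.den < u.den →
    (1 - ω v.den) * Ψ v.den ≤ |x - v|

namespace Admissible

lemma abs_sub_le_of_mem_contactInterval (h : Admissible Ψ ω) {w : ℚ} {x : ℝ}
    (hx : x ∈ contactInterval Ψ ω w) : |x - w| ≤ Ψ w.den := by
  have hω := h.mul_le_half (cast_den_pos w)
  have hΨ := h.decay.pos _ (cast_den_pos w)
  exact abs_le.2 ⟨by linarith [hx.1], by linarith [hx.2]⟩

lemma le_abs_sub_of_den_lt (h : Admissible Ψ ω) {w v : ℚ} (hw : IsRemote Ψ w)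
    (hv : v.den < w.den) {x : ℝ} (hx : x ∈ contactInterval Ψ ω w) : Ψ w.den ≤ |x - v| := by
  have hΨ := h.decay.pos _ (cast_den_pos w)
  have hwv : 44 * Ψ w.den ≤ |(w : ℝ) - v| := by
    refine le_trans ?_ (hw v hv)
    rw [le_div_iff₀ (by positivity), mul_assoc, mul_comm (Ψ _)]
    gcongr
  have hxw := h.abs_sub_le_of_mem_contactInterval hx
  rw [abs_sub_comm] at hxw
  linarith [abs_sub_le (w : ℝ) x v]

lemma one_sub_mul_le (h : Admissible Ψ ω) {q : ℝ} (hq : 0 < q) : (1 - ω q) * Ψ q ≤ Ψ q :=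
  mul_le_of_le_one_left (h.decay.pos q hq).le (by linarith [h.pos_right hq])

section Children

variable {J T : ℕ} {w u v : ℚ} {y : ℝ}

lemma avoidRadius_le (h : Admissible Ψ ω) (hJ : IsThreshold Ψ ω J) (hwJ : 2 ^ J ≤ w.den)
    (hw : IsRemote Ψ w) (hT₀ : 0 < T) (hT : 45 * Ψ T ≤ Ψ w.den * ω w.den / 10) (hvw : v ≠ w)
    (hden : w.den ≤ v.den) {x : ℝ} (hx : x ∈ contactInterval Ψ ω w)
    (hxv : |x - v| ≤ avoidRadius Ψ T v) : avoidRadius Ψ T v ≤ Ψ w.den * ω w.den / 10 := by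
  rw [avoidRadius] at hxv ⊢
  split_ifs at hxv ⊢ with hvT
  · linarith [hJ.le_of_near_contactInterval h hwJ hw hvw hden hx hxv]
  · linarith [h.decay.le_of_le (Nat.cast_pos.2 hT₀) (Nat.cast_le.2 (not_lt.1 hvT))]

theorem volume_not_avoids_le (h : Admissible Ψ ω) (hJ : IsThreshold Ψ ω J) (hwJ : 2 ^ J ≤ w.den)
    (hw : IsRemote Ψ w) (hT₀ : 0 < T) (hT : 45 * Ψ T ≤ Ψ w.den * ω w.den / 10) :
    MeasureTheory.volume {y ∈ contactInterval Ψ ω w | ¬ Avoids Ψ w T y}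
      ≤ ENNReal.ofReal (Ψ w.den * ω w.den / 4) := by
  set f := Ψ w.den * ω w.den
  have hf₀ : 0 < f := h.decay_mul.pos _ (cast_den_pos w)
  set S : Set ℚ := {v | v ≠ w ∧ w.den ≤ v.den ∧
    ∃ x ∈ contactInterval Ψ ω w, |x - v| ≤ avoidRadius Ψ T v}
  have hradius : ∀ v ∈ S, avoidRadius Ψ T v ≤ f / 10 := fun v ⟨hvw, hden, _, hx, hxv⟩ =>
    h.avoidRadius_le hJ hwJ hw hT₀ hT hvw hden hx hxv
  have hcover : {y ∈ contactInterval Ψ ω w | ¬ Avoids Ψ w T y}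
      ⊆ ⋃ v ∈ S, Metric.closedBall (v : ℝ) (avoidRadius Ψ T v) := by
    rintro y ⟨hy, hy'⟩
    simp only [Avoids, not_forall, not_lt] at hy'
    obtain ⟨v, hvw, hden, hyv⟩ := hy'
    exact mem_biUnion (show v ∈ S from ⟨hvw, hden, y, hy, hyv⟩) hyv
  have hmem : ∀ v ∈ S, (v : ℝ) ∈ Icc (w + Ψ w.den - f - f / 10)
      (w + Ψ w.den - f - f / 10 + 6 / 5 * f) := by
    rintro v hv
    obtain ⟨-, -, x, hx, hxv⟩ := id hv
    have hxv' := abs_le.1 (hxv.trans (hradius v hv))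
    exact ⟨by linarith [hx.1], by linarith [hx.2]⟩
  have hg_anti : AntitoneOn (fun q => 45 * Ψ q) (Ioi 0) := fun a ha b hb hab =>
    mul_le_mul_of_nonneg_left (h.decay.antitoneOn ha hb hab) (by norm_num)
  have hg (q : ℝ) (hq : 0 < q) : 0 ≤ 45 * Ψ q := mul_nonneg (by norm_num) (h.decay.pos q hq).le
  have hsum : ∑' k : ℕ, 4 ^ (k + J) * (45 * Ψ (2 ^ (k + J))) ≤ 45 / 100000 := by
    simp only [mul_left_comm _ (45 : ℝ)]
    rw [tsum_mul_left]
    linarith [hJ.tail_le]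
  refine (MeasureTheory.measure_mono hcover).trans
    ((volume_iUnion_closedBall_rat_le hg_anti hg ?_ (by positivity) (by positivity) hmem
      (fun v hv => hwJ.trans hv.2.1) hradius ?_).trans
      (ENNReal.ofReal_le_ofReal ?_))
  · simpa only [mul_left_comm _ (45 : ℝ)] using (h.decay.summable_condensed h.summable).mul_left 45
  · intro v _
    rw [avoidRadius]
    have hv := h.decay.pos _ (cast_den_pos v)
    split_ifs <;> linarith
  · have := mul_le_mul_of_nonneg_left hsum (show 0 ≤ 8 * (6 / 5 * f) by positivity)
    linarith

lemma half_le_abs_sub_of_avoids (h : Admissible Ψ ω) (hw : IsRemote Ψ w) (hwT : w.den ≤ T)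
    (hy : y ∈ contactInterval Ψ ω w) (hav : Avoids Ψ w T y) (hvT : v.den < T) :
    Ψ T / 2 ≤ |y - v| := by
  have hΨT : Ψ T ≤ Ψ w.den := h.decay.le_of_le (cast_den_pos w) (Nat.cast_le.2 hwT)
  have hΨT₀ : 0 < Ψ T := h.decay.pos _ (Nat.cast_pos.2 (v.den_pos.trans hvT))
  rcases lt_or_ge v.den w.den with hlt | hge
  · linarith [h.le_abs_sub_of_den_lt hw hlt hy]
  · rcases eq_or_ne v w with rfl | hvw
    · linarith [le_abs_self (y - v), hy.1, h.mul_le_half (cast_den_pos v)]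
    · have hfar := hav v hvw hge
      rw [avoidRadius, if_pos hvT] at hfar
      linarith [h.decay.le_of_le (cast_den_pos v) (Nat.cast_le.2 hvT.le : (v.den : ℝ) ≤ T)]

lemma mul_le_abs_sub_of_avoids (h : Admissible Ψ ω) (hJ : IsThreshold Ψ ω J) (hwJ : 2 ^ J ≤ w.den)
    (hwT : w.den < T) (hav : Avoids Ψ w T y) (hyu : |y - u| ≤ 40 / (u.den : ℝ) ^ 2)
    (hTv : T ≤ v.den) (hvu : v.den < u.den) : 44 * Ψ v.den ≤ |(u : ℝ) - v| := by
  have hΨv := h.decay.pos _ (cast_den_pos v)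
  by_cases hbig : 40 / (u.den : ℝ) ^ 2 ≤ Ψ v.den
  · have hfar := hav v (by rintro rfl; exact (hwT.trans_le hTv).false) (hwT.le.trans hTv)
    rw [avoidRadius, if_neg hTv.not_gt] at hfar
    linarith [abs_sub_le y u v]
  · refine le_trans ?_ (one_div_den_mul_den_le_abs_sub (by rintro rfl; exact hvu.false))
    rw [not_le, lt_div_iff₀ (by positivity)] at hbig
    have hsmall := hJ.sq_mul_le h (q := v.den) (by exact_mod_cast hwJ.trans (hwT.le.trans hTv))
    rw [le_div_iff₀ (by positivity), ← sq_le_one_iff₀ (by positivity)]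
    calc (44 * Ψ v.den * ((u.den : ℝ) * v.den)) ^ 2
        = 44 ^ 2 * (Ψ v.den * (u.den : ℝ) ^ 2 * ((v.den : ℝ) ^ 2 * Ψ v.den)) := by ring
      _ ≤ 44 ^ 2 * (40 * (1 / 100000)) := by gcongr
      _ ≤ 1 := by norm_num

lemma isRemote_of_avoids (h : Admissible Ψ ω) (hJ : IsThreshold Ψ ω J) (hwJ : 2 ^ J ≤ w.den)
    (hw : IsRemote Ψ w) (hwT : w.den < T) (hy : y ∈ contactInterval Ψ ω w) (hav : Avoids Ψ w T y)
    (hyu : |y - u| ≤ 40 / (u.den : ℝ) ^ 2) (hyuT : |y - u| ≤ Ψ T / 200)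
    (hu : (u.den : ℝ) ^ 2 * Ψ u.den ≤ Ψ T / 200) : IsRemote Ψ u := by
  intro v hvu
  have hv : 1 ≤ (v.den : ℝ) := Nat.one_le_cast.2 v.den_pos
  have hΨT : 0 < Ψ T := h.decay.pos _ (Nat.cast_pos.2 (w.den_pos.trans hwT))
  rcases lt_or_ge v.den T with hvT | hTv
  · have hfar := h.half_le_abs_sub_of_avoids hw hwT.le hy hav hvT
    calc 44 * ((u.den : ℝ) ^ 2 * Ψ u.den) / (v.den : ℝ) ^ 2 ≤ 44 * (Ψ T / 200) / 1 ^ 2 := by gcongr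
      _ ≤ |(u : ℝ) - v| := by linarith [abs_sub_le y u v]
  · refine le_trans ?_ (h.mul_le_abs_sub_of_avoids hJ hwJ hwT hav hyu hTv hvu)
    rw [div_le_iff₀ (by positivity)]
    linarith [h.decay.sq_mul_le (cast_den_pos v) (Nat.cast_le.2 hvu.le)]

lemma le_abs_sub_of_avoids (h : Admissible Ψ ω) (hJ : IsThreshold Ψ ω J) (hwJ : 2 ^ J ≤ w.den)
    (hwT : w.den < T) (hav : Avoids Ψ w T y) (hyu : |y - u| ≤ 40 / (u.den : ℝ) ^ 2)
    (hyuT : |y - u| ≤ Ψ T / 200) (hu : Ψ u.den ≤ Ψ T / 200)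
    (hsub : contactInterval Ψ ω u ⊆ contactInterval Ψ ω w) {x : ℝ} (hx : x ∈ contactInterval Ψ ω u)
    (hwv : w.den ≤ v.den) (hvu : v.den < u.den) : (1 - ω v.den) * Ψ v.den ≤ |x - v| := by
  have hxu := h.abs_sub_le_of_mem_contactInterval hx
  have hΨT : 0 < Ψ T := h.decay.pos _ (Nat.cast_pos.2 (w.den_pos.trans hwT))
  rw [abs_sub_comm] at hxu
  rcases eq_or_ne v w with rfl | hvw
  · linarith [(hsub hx).1, le_abs_self (x - v)]
  refine (h.one_sub_mul_le (cast_den_pos v)).trans ?_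
  rcases lt_or_ge v.den T with hvT | hTv
  · have hyv := hav v hvw hwv
    rw [avoidRadius, if_pos hvT] at hyv
    linarith [h.decay.le_of_le (cast_den_pos v) (Nat.cast_le.2 hvT.le : (v.den : ℝ) ≤ T),
      abs_sub_le y u v, abs_sub_le (u : ℝ) x v]
  · have hΨv := h.decay.pos _ (cast_den_pos v)
    linarith [h.mul_le_abs_sub_of_avoids hJ hwJ hwT hav hyu hTv hvu, abs_sub_le (u : ℝ) x v,
      h.decay.le_of_le (cast_den_pos v) (Nat.cast_le.2 hvu.le)]

lemma isChild_of_avoids (h : Admissible Ψ ω) (hJ : IsThreshold Ψ ω J) (hwJ : 2 ^ J ≤ w.den)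
    (hw : IsRemote Ψ w) (hwT : w.den < T) (hTu : T ≤ u.den) {τ : ℝ} (hτT : τ ≤ Ψ T / 200)
    (hτ : τ ≤ Ψ w.den * ω w.den / 40) (hy : |y - (w + Ψ w.den - Ψ w.den * ω w.den / 2)|
      ≤ 9 / 20 * (Ψ w.den * ω w.den)) (hav : Avoids Ψ w T y)
    (hyu : |y - u| ≤ 40 / (u.den : ℝ) ^ 2) (huτ : 40 / (u.den : ℝ) ^ 2 ≤ τ)
    (hu : (u.den : ℝ) ^ 2 * Ψ u.den ≤ τ) : IsChild Ψ ω w u := by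
  have hf : 0 < Ψ w.den * ω w.den := h.decay_mul.pos _ (cast_den_pos w)
  have hΨu : Ψ u.den ≤ τ :=
    (le_mul_of_one_le_left (h.decay.pos _ (cast_den_pos u)).le
      (one_le_pow₀ (Nat.one_le_cast.2 u.den_pos))).trans hu
  have hy' := abs_le.1 hy
  have hyI : y ∈ contactInterval Ψ ω w := ⟨by linarith, by linarith⟩
  have hsub : contactInterval Ψ ω u ⊆ contactInterval Ψ ω w := by
    intro x hx
    have hxu := abs_le.1 (h.abs_sub_le_of_mem_contactInterval hx)
    have hyu' := abs_le.1 (hyu.trans huτ)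
    exact ⟨by linarith, by linarith⟩
  have hyuT := (hyu.trans huτ).trans hτT
  exact ⟨hwT.trans_le hTu, h.isRemote_of_avoids hJ hwJ hw hwT hyI hav hyu hyuT (hu.trans hτT), hsub,
    fun x hx v => h.le_abs_sub_of_avoids hJ hwJ hwT hav hyu hyuT (hΨu.trans hτT) hsub hx⟩

lemma exists_forall_isChild (h : Admissible Ψ ω) (hJ : IsThreshold Ψ ω J) (hwJ : 2 ^ J ≤ w.den)
    (hw : IsRemote Ψ w) (hwT : w.den < T) :
    ∃ D : ℕ, ∀ u : ℚ, D ≤ u.den → ∀ y : ℝ, |y - (w + Ψ w.den - Ψ w.den * ω w.den / 2)|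
      ≤ 9 / 20 * (Ψ w.den * ω w.den) → Avoids Ψ w T y → |y - u| ≤ 40 / (u.den : ℝ) ^ 2 →
      IsChild Ψ ω w u := by
  have hf : 0 < Ψ w.den * ω w.den := h.decay_mul.pos _ (cast_den_pos w)
  have hΨT : 0 < Ψ T := h.decay.pos _ (Nat.cast_pos.2 (w.den_pos.trans hwT))
  set τ := min (Ψ T / 200) (Ψ w.den * ω w.den / 40)
  have hτ₀ : 0 < τ := lt_min (by positivity) (by positivity)
  have hinv : ∀ᶠ d : ℝ in atTop, 40 / d ^ 2 ≤ τ :=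
    (tendsto_const_nhds.div_atTop (tendsto_pow_atTop two_ne_zero)).eventually
      (eventually_le_nhds hτ₀)
  obtain ⟨D, hD⟩ := eventually_atTop.1 (tendsto_natCast_atTop_atTop.eventually
    (hinv.and (h.decay.eventually_sq_mul_le h.summable hτ₀)))
  refine ⟨max T D, fun u hu y hy hav hyu => ?_⟩
  obtain ⟨huτ, hΨuτ⟩ := hD u.den ((le_max_right _ _).trans hu)
  exact h.isChild_of_avoids hJ hwJ hw hwT ((le_max_left _ _).trans hu) (min_le_left _ _)
    (min_le_right _ _) hy hav hyu huτ hΨuτ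

theorem eventually_exists_children (h : Admissible Ψ ω) (hJ : IsThreshold Ψ ω J)
    (hwJ : 2 ^ J ≤ w.den) (hw : IsRemote Ψ w) :
    ∀ᶠ X : ℕ in atTop, ∃ F : Finset ℚ, (X : ℝ) ^ 2 * (Ψ w.den * ω w.den) / 160 ≤ F.card ∧
      ∀ u ∈ F, (X : ℝ) / 40 ≤ u.den ∧ u.den ≤ X ∧ IsChild Ψ ω w u := by
  set f := Ψ w.den * ω w.den
  have hf₀ : 0 < f := h.decay_mul.pos _ (cast_den_pos w)
  obtain ⟨T, hT, hwT⟩ := (((h.decay.tendsto_zero.comp tendsto_natCast_atTop_atTop).eventually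
    (eventually_le_nhds (show 0 < f / 450 by positivity))).and (eventually_gt_atTop w.den)).exists
  rw [Function.comp_apply] at hT
  obtain ⟨D, hD⟩ := h.exists_forall_isChild hJ hwJ hw hwT
  set B := {y ∈ contactInterval Ψ ω w | ¬ Avoids Ψ w T y}
  have hB : MeasureTheory.volume B ≤ ENNReal.ofReal (f / 4) :=
    h.volume_not_avoids_le hJ hwJ hw (w.den_pos.trans hwT) (by linarith)
  filter_upwards [eventually_exists_finset_rat_near (w + Ψ w.den - f + f / 20)
    (show 0 < 9 / 10 * f by positivity) (show (1 : ℝ) ≤ 40 by norm_num) B,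
    eventually_ge_atTop (40 * D), eventually_gt_atTop 0] with X hX hXD hX₀
  obtain ⟨F, hF, hcard⟩ := hX
  refine ⟨F, ?_, fun u hu => ?_⟩
  · replace hcard := hcard.trans (add_le_add_left (add_le_add_right hB _) _)
    rw [← ENNReal.ofReal_add (by positivity) (by positivity),
      ← ENNReal.ofReal_add (by positivity) (by positivity),
      ENNReal.ofReal_le_ofReal_iff (by positivity)] at hcard
    have hhalf : f / 2 ≤ F.card * (2 * (40 / (X : ℝ) ^ 2)) := by linarith
    rw [← mul_div_assoc, ← mul_div_assoc, le_div_iff₀ (by positivity)] at hhalf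
    linarith
  · obtain ⟨hu_ge, hu_le, y, hy, hyB, hyu⟩ := hF u hu
    have hD_le : D ≤ u.den := by
      have : (40 * D : ℝ) ≤ X := by exact_mod_cast hXD
      exact_mod_cast (show (D : ℝ) ≤ u.den by linarith)
    have hmid : |y - (w + Ψ w.den - f / 2)| ≤ 9 / 20 * f :=
      abs_le.2 ⟨by linarith [hy.1], by linarith [hy.2]⟩
    have hyI : y ∈ contactInterval Ψ ω w := ⟨by linarith [hy.1], by linarith [hy.2]⟩
    refine ⟨hu_ge, by exact_mod_cast hu_le, hD u hD_le y hmid ?_ (hyu.trans ?_)⟩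
    · exact not_not.1 fun hnot => hyB ⟨hyI, hnot⟩
    · gcongr

end Children

end Admissible

section Levels

variable {J X X' : ℕ} {w₀ : ℚ} {s : ℝ}

/-- The rationals with denominator between `X / 40` and `X` which are available as nodes of the tree
rooted at `w₀`. -/
def nodeSet (Ψ ω : ℝ → ℝ) (J : ℕ) (w₀ : ℚ) (X : ℕ) : Set ℚ :=
  {w | 2 ^ J ≤ w.den ∧ (X : ℝ) / 40 ≤ w.den ∧ w.den ≤ X ∧ IsRemote Ψ w ∧
    contactInterval Ψ ω w ⊆ contactInterval Ψ ω w₀}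

/-- The number of children given to each node when the denominators of the next level of the tree
are of order `X'`. -/
noncomputable def childCount (Ψ ω : ℝ → ℝ) (X X' : ℕ) : ℕ :=
  ⌊(X' : ℝ) ^ 2 * (Ψ X * ω X) / 160⌋₊

/-- The denominators of order `X'` may follow those of order `X` in the tree: all nodes have enough
children, and `X'` is large enough for the natural measure on the tree to satisfy a Frostman
condition of exponent `s`. -/
structure IsNextLevel (Ψ ω : ℝ → ℝ) (J : ℕ) (w₀ : ℚ) (s : ℝ) (X X' : ℕ) : Prop where
  lt : X < X'
  two_le : 2 ≤ (X' : ℝ) ^ 2 * (Ψ X * ω X) / 160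
  le_mul_rpow : 320 / (Ψ X * ω X) ≤ (X' : ℝ) ^ 2 * (Ψ X' * ω X') ^ s
  exists_children : ∀ w ∈ nodeSet Ψ ω J w₀ X, ∃ c : Fin (childCount Ψ ω X X') → ℚ,
    Function.Injective c ∧ ∀ j, c j ∈ nodeSet Ψ ω J w₀ X' ∧ IsChild Ψ ω w (c j)

namespace IsNextLevel

lemma two_le_childCount (hX : IsNextLevel Ψ ω J w₀ s X X') : 2 ≤ childCount Ψ ω X X' :=
  Nat.le_floor (by exact_mod_cast hX.two_le)

lemma le_childCount (hX : IsNextLevel Ψ ω J w₀ s X X') :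
    (X' : ℝ) ^ 2 * (Ψ X * ω X) / 320 ≤ childCount Ψ ω X X' := by
  have hfloor := Nat.lt_floor_add_one ((X' : ℝ) ^ 2 * (Ψ X * ω X) / 160)
  rw [childCount]
  linarith [hX.two_le]

lemma inv_childCount_le (hX : IsNextLevel Ψ ω J w₀ s X X') (hf : 0 < Ψ X * ω X)
    (hf' : 0 ≤ Ψ X' * ω X') : (childCount Ψ ω X X' : ℝ)⁻¹ ≤ (Ψ X' * ω X') ^ s := by
  have hn : (0 : ℝ) < childCount Ψ ω X X' :=
    Nat.cast_pos.2 (two_pos.trans_le hX.two_le_childCount)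
  have hlarge := hX.le_mul_rpow
  rw [div_le_iff₀ hf] at hlarge
  rw [inv_le_iff_one_le_mul₀ hn]
  calc (1 : ℝ) ≤ (Ψ X' * ω X') ^ s * ((X' : ℝ) ^ 2 * (Ψ X * ω X) / 320) := by linarith
    _ ≤ (Ψ X' * ω X') ^ s * childCount Ψ ω X X' := by gcongr; exact hX.le_childCount

lemma rpow_le (hX : IsNextLevel Ψ ω J w₀ s X X') (hf : 0 ≤ Ψ X * ω X) (hs : 0 ≤ s) :
    (Ψ X * ω X) ^ s ≤ 640 ^ s * (childCount Ψ ω X X' * (1 / (2 * (X' : ℝ) ^ 2))) ^ s := by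
  have hX' : (0 : ℝ) < X' := Nat.cast_pos.2 ((Nat.zero_le X).trans_lt hX.lt)
  rw [← Real.mul_rpow (by norm_num) (by positivity)]
  refine Real.rpow_le_rpow hf ?_ hs
  rw [mul_one_div, ← mul_div_assoc, le_div_iff₀ (by positivity)]
  linarith [hX.le_childCount]

lemma prod_inv_le {X : ℕ → ℕ} (hX : ∀ k, IsNextLevel Ψ ω J w₀ s (X k) (X (k + 1)))
    (hf : ∀ k, 0 < Ψ (X k) * ω (X k)) (hs : 0 ≤ s) {k : ℕ} (hk : 0 < k) :
    ∏ i ∈ Finset.range k, (childCount Ψ ω (X i) (X (i + 1)) : ℝ)⁻¹ ≤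
      640 ^ s * (childCount Ψ ω (X k) (X (k + 1)) * (1 / (2 * (X (k + 1) : ℝ) ^ 2))) ^ s := by
  obtain ⟨k, rfl⟩ := Nat.exists_eq_succ_of_ne_zero hk.ne'
  refine le_trans ?_ ((hX (k + 1)).rpow_le (hf _).le hs)
  have hprod : ∏ i ∈ Finset.range k, (childCount Ψ ω (X i) (X (i + 1)) : ℝ)⁻¹ ≤ 1 :=
    Finset.prod_le_one (fun i _ => by positivity) fun i _ =>
      inv_le_one_of_one_le₀ (Nat.one_le_cast.2 (one_le_two.trans (hX i).two_le_childCount))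
  rw [Finset.prod_range_succ, ← one_mul ((Ψ _ * ω _) ^ s)]
  exact mul_le_mul hprod ((hX k).inv_childCount_le (hf k) (hf (k + 1)).le) (by positivity)
    zero_le_one

end IsNextLevel

namespace Admissible

lemma exists_isRemote (h : Admissible Ψ ω) (N : ℕ) : ∃ w : ℚ, N ≤ w.den ∧ IsRemote Ψ w := by
  obtain ⟨c, hc, hsqrt⟩ := exists_pos_div_den_sq_le_abs_sqrt_two_sub
  set c' := min (c / 2) (√(c / 2))
  have hc' : 0 < c' / 44 := div_pos (lt_min (by positivity) (by positivity)) (by norm_num)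
  obtain ⟨Q, hQ⟩ := eventually_atTop.1 (h.decay.eventually_sq_mul_le h.summable hc')
  obtain ⟨w, hw, hfar⟩ :=
    exists_rat_forall_den_lt_div_den_sq_le irrational_sqrt_two hc hsqrt (max N ⌈Q⌉₊)
  refine ⟨w, (le_max_left _ _).trans hw, fun v hv => le_trans ?_ (hfar v hv)⟩
  have hΨ := hQ w.den ((Nat.le_ceil Q).trans (Nat.cast_le.2 ((le_max_right _ _).trans hw)))
  gcongr
  linarith

lemma one_sub_mul_le_of_dvd (h : Admissible Ψ ω) {d q : ℕ} (hdq : d ∣ q) (hq : 0 < q) :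
    (1 - ω q) * Ψ q ≤ (1 - ω d) * Ψ d := by
  rcases eq_or_ne d q with rfl | hne
  · rfl
  have hd : 0 < (d : ℝ) := Nat.cast_pos.2 (Nat.pos_of_dvd_of_pos hdq hq)
  have htwo : 2 * (d : ℝ) ≤ q := by
    obtain ⟨c, rfl⟩ := hdq
    have hc : 2 ≤ c := by
      by_contra! hc
      interval_cases c <;> simp_all
    rw [mul_comm]
    exact_mod_cast Nat.mul_le_mul_left d hc
  have hq₀ : (0 : ℝ) < q := Nat.cast_pos.2 hq
  have hΨq := h.decay.pos q hq₀
  have hΨd : 4 * Ψ q ≤ Ψ d := by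
    refine le_of_mul_le_mul_left ?_ (show 0 < (d : ℝ) ^ 2 by positivity)
    calc (d : ℝ) ^ 2 * (4 * Ψ q) = (2 * d) ^ 2 * Ψ q := by ring
      _ ≤ (q : ℝ) ^ 2 * Ψ q := by gcongr
      _ ≤ (d : ℝ) ^ 2 * Ψ d := h.decay.sq_mul_le hd (by linarith)
  linarith [h.one_sub_mul_le hq₀, h.mul_le_half hd]

lemma one_sub_mul_le_abs_sub_of_chain {w : ℕ → ℚ} (hw : ∀ k, IsChild Ψ ω (w k) (w (k + 1)))
    {x : ℝ} (hx : ∀ k, x ∈ contactInterval Ψ ω (w k)) {v : ℚ} (hv : (w 0).den ≤ v.den) :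
    (1 - ω v.den) * Ψ v.den ≤ |x - v| := by
  have hmono : StrictMono fun k => (w k).den := strictMono_nat_of_lt_succ fun k => (hw k).den_lt
  have hex : ∃ k, v.den < (w k).den := ⟨v.den + 1, hmono.le_apply (x := v.den + 1)⟩
  obtain ⟨k, hk⟩ := Nat.exists_eq_succ_of_ne_zero
    (fun h₀ => ((h₀ ▸ Nat.find_spec hex).trans_le hv).false : Nat.find hex ≠ 0)
  have hlt := Nat.find_spec hex
  rw [hk] at hlt
  have hle : (w k).den ≤ v.den := not_lt.1 (Nat.find_min hex (hk ▸ k.lt_succ_self))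
  exact (hw k).le_abs_sub x (hx (k + 1)) v hle hlt

theorem mem_exactSet_of_chain (h : Admissible Ψ ω) {w : ℕ → ℚ} (hw₀ : IsRemote Ψ (w 0))
    (hw : ∀ k, IsChild Ψ ω (w k) (w (k + 1))) {x : ℝ}
    (hx : ∀ k, x ∈ contactInterval Ψ ω (w k)) : x ∈ exactSet Ψ ω := by
  constructor
  · have hmono : StrictMono fun k => (w k).den := strictMono_nat_of_lt_succ fun k => (hw k).den_lt
    refine infinite_of_injective_forall_mem (f := fun k => ((w k).num, (w k).den))
      (fun j k hjk => hmono.injective (congrArg Prod.snd hjk)) fun k => ⟨(w k).den_pos, ?_⟩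
    rw [← Rat.cast_def]
    exact h.abs_sub_le_of_mem_contactInterval (hx k)
  · filter_upwards [eventually_ge_atTop (w 0).den] with q hq p
    have hq₀ : 0 < q := (w 0).den_pos.trans_le hq
    obtain ⟨v, hv⟩ : ∃ v : ℚ, v = p / q := ⟨_, rfl⟩
    have hcast : (v : ℝ) = p / q := by rw [hv]; push_cast; rfl
    rw [← hcast]
    rcases lt_or_ge v.den (w 0).den with hlt | hge
    · calc (1 - ω q) * Ψ q ≤ Ψ q := h.one_sub_mul_le (Nat.cast_pos.2 hq₀)
        _ ≤ Ψ (w 0).den := h.decay.le_of_le (cast_den_pos _) (Nat.cast_le.2 hq)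
        _ ≤ |x - v| := h.le_abs_sub_of_den_lt hw₀ hlt (hx 0)
    · have hdvd : v.den ∣ q := by
        have := Rat.den_dvd p q
        rw [Rat.divInt_eq_div] at this
        rw [hv]
        exact_mod_cast this
      exact (h.one_sub_mul_le_of_dvd hdvd hq₀).trans (one_sub_mul_le_abs_sub_of_chain hw hx hge)

lemma finite_nodeSet (h : Admissible Ψ ω) : (nodeSet Ψ ω J w₀ X).Finite := by
  refine (finite_setOf_den_le_mem_Icc X (w₀ - Ψ 1) (w₀ + Ψ w₀.den)).subset ?_
  rintro w ⟨-, -, hwX, -, hsub⟩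
  have hf := h.decay_mul.pos _ (cast_den_pos w)
  have hend := hsub (right_mem_Icc.2 (by linarith) : (w : ℝ) + Ψ w.den ∈ contactInterval Ψ ω w)
  have hΨ : Ψ w.den ≤ Ψ 1 := h.decay.le_of_le one_pos (Nat.one_le_cast.2 w.den_pos)
  have hΨ₀ := h.decay.pos _ (cast_den_pos w₀)
  exact ⟨hwX, by linarith [hend.1, h.mul_le_half (cast_den_pos w₀)],
    by linarith [hend.2, h.decay.pos _ (cast_den_pos w)]⟩

lemma one_div_le_abs_sub_of_mem_nodeSet (h : Admissible Ψ ω) (hJ : IsThreshold Ψ ω J)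
    {u v : ℚ} (hu : u ∈ nodeSet Ψ ω J w₀ X)
    (hv : v ∈ nodeSet Ψ ω J w₀ X) (huv : u ≠ v) {x y : ℝ} (hx : x ∈ contactInterval Ψ ω u)
    (hy : y ∈ contactInterval Ψ ω v) : 1 / (2 * (X : ℝ) ^ 2) ≤ |x - y| := by
  have hX : (0 : ℝ) < X := Nat.cast_pos.2 (u.den_pos.trans_le hu.2.2.1)
  have hnear : ∀ w ∈ nodeSet Ψ ω J w₀ X, ∀ z ∈ contactInterval Ψ ω w,
      |z - w| ≤ 1 / X ^ 2 / 4 := by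
    rintro w ⟨hJw, hXw, -⟩ z hz
    refine (h.abs_sub_le_of_mem_contactInterval hz).trans ?_
    have hΨw := h.decay.pos _ (cast_den_pos w)
    have hsmall : ((X : ℝ) / 40) ^ 2 * Ψ w.den ≤ 1 / 100000 :=
      le_trans (by gcongr) (hJ.sq_mul_le h (q := w.den) (by exact_mod_cast hJw))
    rw [div_div, le_div_iff₀ (by positivity)]
    linarith
  have hsep : 1 / (X : ℝ) ^ 2 ≤ |(u : ℝ) - v| :=
    one_div_sq_le_abs_sub huv (Nat.cast_le.2 hu.2.2.1) (Nat.cast_le.2 hv.2.2.1)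
  have hux := hnear u hu x hx
  have hyv := hnear v hv y hy
  rw [abs_sub_comm] at hux
  rw [mul_comm, ← div_div]
  linarith [abs_sub_le (u : ℝ) x v, abs_sub_le x y v]

lemma exists_isNextLevel (h : Admissible Ψ ω) (hJ : IsThreshold Ψ ω J) (hs : 0 < s)
    (hlt : ENNReal.ofReal s < convergenceExponent Ψ ω) (hX : 0 < X) :
    ∃ X', IsNextLevel Ψ ω J w₀ s X X' := by
  have hX₀ : (0 : ℝ) < X := Nat.cast_pos.2 hX
  have hchild := (eventually_all_finite (h.finite_nodeSet (J := J) (w₀ := w₀) (X := X))).2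
    fun w hw => h.eventually_exists_children hJ hw.1 hw.2.2.2.1
  have hlarge : Tendsto (fun X' : ℕ => (X' : ℝ) ^ 2 * (Ψ X * ω X) / 160) atTop atTop :=
    (((tendsto_pow_atTop two_ne_zero).comp tendsto_natCast_atTop_atTop).atTop_mul_const
      (h.decay_mul.pos _ hX₀)).atTop_div_const (by norm_num)
  obtain ⟨X', hfrost, hchild, htwo, hXX'⟩ := ((frequently_le_sq_mul_rpow
    (fun q hq => h.decay_mul.pos q (Nat.cast_pos.2 hq)) hs hlt
    (320 / (Ψ X * ω X))).and_eventually (hchild.and ((hlarge.eventually_ge_atTop 2).and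
      (eventually_gt_atTop X)))).exists
  refine ⟨X', hXX', htwo, hfrost, fun w hw => ?_⟩
  obtain ⟨F, hF, hFchild⟩ := hchild w hw
  have hcard : childCount Ψ ω X X' ≤ F.card := by
    refine Nat.floor_le_of_le (le_trans ?_ hF)
    have := h.decay_mul.le_of_le (cast_den_pos w) (Nat.cast_le.2 hw.2.2.1)
    gcongr
  refine ⟨fun j => F.equivFin.symm (Fin.castLE hcard j), Subtype.val_injective.comp
    (F.equivFin.symm.injective.comp (Fin.castLE_injective hcard)), fun j => ?_⟩
  obtain ⟨hge, hle, hu⟩ := hFchild _ (F.equivFin.symm (Fin.castLE hcard j)).2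
  exact ⟨⟨hw.1.trans hu.den_lt.le, hge, hle, hu.isRemote, hu.subset.trans hw.2.2.2.2⟩, hu⟩

lemma exists_seq_isNextLevel (h : Admissible Ψ ω) (hJ : IsThreshold Ψ ω J) (hs : 0 < s)
    (hlt : ENNReal.ofReal s < convergenceExponent Ψ ω) (w₀ : ℚ) :
    ∃ X : ℕ → ℕ, X 0 = w₀.den ∧ ∀ k, IsNextLevel Ψ ω J w₀ s (X k) (X (k + 1)) := by
  choose! next hnext using fun X (hX : 0 < X) =>
    h.exists_isNextLevel (J := J) (w₀ := w₀) hJ hs hlt hX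
  have hpos (k : ℕ) : 0 < next^[k] w₀.den := by
    induction k with
    | zero => exact w₀.den_pos
    | succ k ih =>
      rw [Function.iterate_succ_apply']
      exact ih.trans (hnext _ ih).lt
  refine ⟨fun k => next^[k] w₀.den, rfl, fun k => ?_⟩
  simpa only [Function.iterate_succ_apply'] using hnext _ (hpos k)

theorem le_dimH_exactSet_of_lt (h : Admissible Ψ ω) {s : ℝ≥0} (hs : 0 < s)
    (hlt : s < convergenceExponent Ψ ω) : s ≤ dimH (exactSet Ψ ω) := by
  obtain ⟨J, hJ⟩ := h.eventually_isThreshold.exists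
  obtain ⟨w₀, hw₀J, hw₀⟩ := h.exists_isRemote (2 ^ J)
  obtain ⟨X, hX₀, hX⟩ := h.exists_seq_isNextLevel hJ (NNReal.coe_pos.2 hs)
    (by rwa [ENNReal.ofReal_coe_nnreal]) w₀
  have hmono : StrictMono X := strictMono_nat_of_lt_succ fun k => (hX k).lt
  have hpos (k : ℕ) : (0 : ℝ) < X k :=
    Nat.cast_pos.2 ((hX₀ ▸ w₀.den_pos).trans_le (hmono.monotone k.zero_le))
  have hs₁ : s ≤ 1 := by exact_mod_cast hlt.le.trans (convergenceExponent_le_one h.decay_mul)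
  have : ∀ k, NeZero (childCount Ψ ω (X k) (X (k + 1))) := fun k =>
    ⟨(two_pos.trans_le (hX k).two_le_childCount).ne'⟩
  have hroot : w₀ ∈ nodeSet Ψ ω J w₀ (X 0) := by
    rw [hX₀]
    exact ⟨hw₀J, div_le_self (Nat.cast_nonneg _) (by norm_num), le_rfl, hw₀, subset_rfl⟩
  have hδ₀ : Tendsto (fun k => 1 / (2 * (X k : ℝ) ^ 2)) atTop (𝓝 0) :=
    tendsto_const_nhds.div_atTop ((((tendsto_pow_atTop two_ne_zero).comp
      tendsto_natCast_atTop_atTop).comp hmono.tendsto_atTop).const_mul_atTop two_pos)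
  refine le_dimH_of_tree (V := fun k => nodeSet Ψ ω J w₀ (X k)) (I := contactInterval Ψ ω)
    (R := IsChild Ψ ω) (A := 640 ^ (s : ℝ)) hroot (fun _ => isCompact_Icc) (fun u => ?_)
    (fun _ _ huv => huv.subset) (fun k => (hX k).exists_children)
    (fun k => by have := hpos k; positivity) (fun j k hjk => ?_) hδ₀
    (fun k u hu v hv huv x hx y hy => h.one_div_le_abs_sub_of_mem_nodeSet hJ hu hv huv hx hy)
    hs hs₁ ?_ fun w hw hR x hx => h.mem_exactSet_of_chain (hw ▸ hw₀) hR hx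
  · exact nonempty_Icc.2 (by linarith [h.decay_mul.pos _ (cast_den_pos u)])
  · have hj := hpos j
    have hle : (X j : ℝ) ≤ X k := Nat.cast_le.2 (hmono.monotone hjk)
    gcongr
  · filter_upwards [eventually_gt_atTop 0] with k hk
    exact IsNextLevel.prod_inv_le hX (fun i => h.decay_mul.pos _ (hpos i)) s.coe_nonneg hk

theorem convergenceExponent_le_dimH (h : Admissible Ψ ω) :
    convergenceExponent Ψ ω ≤ dimH (exactSet Ψ ω) := by
  refine le_of_forall_lt fun c hc => ?_
  obtain ⟨s, hcs, hs⟩ := ENNReal.lt_iff_exists_nnreal_btwn.1 hc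
  have hs₀ : 0 < s := ENNReal.coe_pos.1 (zero_le.trans_lt hcs)
  exact hcs.trans_le (h.le_dimH_exactSet_of_lt hs₀ hs)

end Admissible

end Levels

section Truncation

variable {ω' : ℝ → ℝ}

lemma exactSet_subset_exactSet (hΨ : ∀ q : ℕ, 0 < q → 0 ≤ Ψ q)
    (hω : ∀ q : ℕ, 0 < q → ω' q ≤ ω q) : exactSet Ψ ω' ⊆ exactSet Ψ ω := by
  refine fun x hx => ⟨hx.1, ?_⟩
  filter_upwards [hx.2, eventually_gt_atTop 0] with q hq hq₀ p
  refine le_trans ?_ (hq p)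
  gcongr
  · exact hΨ q hq₀
  · exact hω q hq₀

lemma admissible_min_half (hΨ : QuadraticDecay Ψ) (hΨω : QuadraticDecay fun q => Ψ q * ω q)
    (hΨ_div : SquareDivisibility Ψ) (hΨ_sum : Summable fun q : ℕ => (q : ℝ) * Ψ q)
    (hω_ge : ∀ᶠ q : ℕ in atTop, 45 / (16 * Ψ q) * Ψ (1 / (8 * Ψ q)) ≤ ω q) :
    Admissible Ψ fun q => min (ω q) (1 / 2) where
  decay := hΨ
  decay_mul := by
    refine ⟨fun q hq => ?_, ?_⟩
    · have hΨq := hΨ.pos q hq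
      exact mul_pos hΨq (lt_min (pos_of_mul_pos_right (hΨω.pos q hq) hΨq.le) (by norm_num))
    · have hhalf : AntitoneOn (fun q : ℝ => q ^ 2 * Ψ q * (1 / 2)) (Ioi 0) := fun a ha b hb hab =>
        mul_le_mul_of_nonneg_right (hΨ.sq_mul_antitoneOn ha hb hab) (by norm_num)
      refine (hΨω.sq_mul_antitoneOn.min hhalf).congr fun q hq => ?_
      have hΨq := hΨ.pos q hq
      dsimp only
      rw [mul_assoc (q ^ 2), ← mul_min_of_nonneg _ _ (sq_nonneg q), ← mul_min_of_nonneg _ _ hΨq.le]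
  le_half _ _ := min_le_right _ _
  div := hΨ_div
  summable := hΨ_sum
  le_mul := by
    filter_upwards [hω_ge, tendsto_natCast_atTop_atTop.eventually
      (hΨ.eventually_mul_apply_inv_le hΨ_sum), eventually_gt_atTop 0] with q hω hinv hq
    have hΨq := hΨ.pos q (Nat.cast_pos.2 hq)
    have hΨinv := hΨ.pos _ (inv_pos.2 hΨq)
    have height := hΨ.mul_apply_inv_le hΨq
    rw [div_mul_eq_mul_div, div_le_iff₀ (by positivity)] at hω
    rw [mul_min_of_nonneg _ _ hΨq.le]
    exact le_min (by linarith) (by linarith)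

end Truncation

end LowerBound

theorem mainTheorem1_general (Ψ ω : ℝ → ℝ)
    (hΨ_pos : ∀ q : ℝ, 0 < q → 0 < Ψ q)
    (hω_mem : ∀ q : ℝ, 0 < q → 0 < ω q ∧ ω q < 1)
    (hΨ_anti : AntitoneOn (fun q : ℝ => q ^ 2 * Ψ q) (Ioi 0))
    (hΨω_anti : AntitoneOn (fun q : ℝ => q ^ 2 * Ψ q * ω q) (Ioi 0))
    (hΨ_div : SquareDivisibility Ψ)
    (hΨ_sum : Summable fun q : ℕ => (q : ℝ) * Ψ q)
    (hω_ge : ∀ᶠ q : ℕ in atTop, 45 / (16 * Ψ q) * Ψ (1 / (8 * Ψ q)) ≤ ω q) :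
    dimH (exactSet Ψ ω) = convergenceExponent Ψ ω ∧
      ((convergenceExponent Ψ ω : ℝ≥0∞) : EReal) = 2 / lowerOrder Ψ ω := by
  have hΨ : QuadraticDecay Ψ := ⟨hΨ_pos, hΨ_anti⟩
  have hΨω : QuadraticDecay fun q => Ψ q * ω q :=
    ⟨fun q hq => mul_pos (hΨ_pos q hq) (hω_mem q hq).1, by simpa only [mul_assoc] using hΨω_anti⟩
  have hadm := admissible_min_half hΨ hΨω hΨ_div hΨ_sum hω_ge
  have hpos (q : ℕ) (hq : 0 < q) : (0 : ℝ) < q := Nat.cast_pos.2 hq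
  refine ⟨le_antisymm ?_ ?_, convergenceExponent_eq_two_div_lowerOrder hΨω⟩
  · exact dimH_exactSet_le (fun q hq => (hΨω.pos q (hpos q hq)).le)
      ((hΨ.tendsto_zero.comp tendsto_natCast_atTop_atTop).eventually (eventually_le_nhds one_pos))
  · calc convergenceExponent Ψ ω ≤ convergenceExponent Ψ fun q => min (ω q) (1 / 2) :=
          convergenceExponent_le_of_le_mul (C := 2) (fun q hq => (hΨω.pos q (hpos q hq)).le)
            (fun q hq => (hadm.decay_mul.pos q (hpos q hq)).le) fun q hq => ?_
      _ ≤ dimH (exactSet Ψ fun q => min (ω q) (1 / 2)) := hadm.convergenceExponent_le_dimH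
      _ ≤ dimH (exactSet Ψ ω) := dimH_mono (exactSet_subset_exactSet
          (fun q hq => (hΨ_pos q (hpos q hq)).le) fun q _ => min_le_left _ _)
    have hω := hω_mem q (hpos q hq)
    rw [mul_left_comm]
    refine mul_le_mul_of_nonneg_left ?_ (hΨ_pos q (hpos q hq)).le
    rcases min_choice (ω q) (1 / 2) with h | h <;> rw [h] <;> linarith

theorem mainTheorem1 (Ψ ω : ℝ → ℝ)
    (hΨ_pos : ∀ q : ℝ, 0 < q → 0 < Ψ q)
    (hω_mem : ∀ q : ℝ, 0 < q → 0 < ω q ∧ ω q < 1)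
    (hΨ_anti : AntitoneOn (fun q : ℝ => q ^ 2 * Ψ q) (Ioi 0))
    (hΨω_anti : AntitoneOn (fun q : ℝ => q ^ 2 * Ψ q * ω q) (Ioi 0))
    (hΨ_div : SquareDivisibility Ψ)
    (hΨ_sum : Summable fun q : ℕ => (q : ℝ) * Ψ q)
    (hω_lim : Tendsto ω atTop (𝓝 0))
    (hω_ge : ∀ᶠ q : ℕ in atTop, 45 / (16 * Ψ q) * Ψ (1 / (8 * Ψ q)) ≤ ω q) :
    dimH (exactSet Ψ ω) = convergenceExponent Ψ ω ∧
      ((convergenceExponent Ψ ω : ℝ≥0∞) : EReal) = 2 / lowerOrder Ψ ω :=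
  mainTheorem1_general Ψ ω hΨ_pos hω_mem hΨ_anti hΨω_anti hΨ_div hΨ_sum hω_ge
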